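/- Let $\mathcal A=\{0,\dots,7\}$, $\mathcal B=\{0,\dots,5\}$. Let $\varphi:\mathcal A^*\to\mathcal A^*$ and $\mu:\mathcal A^*\to\mathcal B^*$ be the morphisms $$\varphi: 0\mapsto 01,\ 1\mapsto 2,\ 2\mapsto 65,\ 3\mapsto 4,\ 4\mapsto 23,\ 5\mapsto 6,\ 6\mapsto 47,\ 7\mapsto 0,$$ $$\mu: 0\mapsto 15,\ 1\mapsto 04,\ 2\mapsto 12,\ 3\mapsto 03,\ 4\mapsto 04,\ 5\mapsto 12,\ 6\mapsto 03,\ 7\mapsto 15.$$ Let $\Psi_0,\Psi_1,\Psi_2$ be the antimorphisms of $\mathcal B^*$ (maps with $\Psi(xy)=\Psi(y)\Psi(x)$) determined on letters by $$\Psi_0: 0\mapsto 0,1\mapsto 1,2\mapsto 4,3\mapsto 5,4\mapsto 2,5\mapsto 3,\quad \Psi_1: 0\mapsto 1,1\mapsto 0,\ x\mapsto x\ (x=2,3,4,5),\quad \Psi_2: 0\mapsto 0,1\mapsto 1,2\mapsto 3,3\mapsto 2,4\mapsto 5,5\mapsto 4.$$ Let $H$ be the group (under composition) generated by $\Psi_0,\Psi_1,\Psi_2$,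 and for $i\in\{0,1,2\}$ let $H_i$ be the group generated by $\Psi_i$ and $\Psi_{(i+1)\bmod 3}$. Definitions. A symmetry group on $\mathcal B^*$ is a finite group $G$ of morphisms and antimorphisms of $\mathcal B^*$ containing at least one antimorphism. Let $\mathbf w$ be an infinite word over $\mathcal B$ with language (set of finite factors) $\mathcal L(\mathbf w)$. The language is closed under $G$ if $\nu(x)\in\mathcal L(\mathbf w)$ for all $x\in\mathcal L(\mathbf w)$, $\nu\in G$. Write $[x]=\{\nu(x):\nu\in G\}$. A factor $x$ is special if at least two letters $a$ satisfy $ax\in\mathcal L(\mathbf w)$ or at least two letters $a$ satisfy $xa\in\mathcal L(\mathbf w)$. The undirected graph of symmetries $\Gamma_n(\mathbf w)$ (loops and multiple edges allowed) has as vertices the classes $[x]$ of special factors $x$ of length $n$; its edges are the classes $[e]$ of factors $e$ of $\mathbf w$ of length at least $n+1$ whose prefix and suffix of length $n$ are special and none of whose other factors of length $n$ (at intermediate positions) is special, and $[e]$ connects the class of the prefix to the class of the suffix of length $n$ of $e$. The word $\mathbf w$ is $G$-rich if $\mathcal L(\mathbf w)$ is closed under $G$ and, for every $n\ge 1$, (i)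 whenever $[e]$ is a loop of $\Gamma_n(\mathbf w)$, $\Theta(e)=e$ for some antimorphism $\Theta\in G$; (ii) the graph obtained from $\Gamma_n(\mathbf w)$ by removing all loops is a tree (in particular it has no multiple edges). Claim. The morphism $\varphi$ has a unique infinite fixed point $\mathbf u$ (the infinite word having every $\varphi^k(0)$, $k\ge 0$, as a prefix). Let $\mathbf v=\mu(\mathbf u)$. Then every letter of $\mathcal B$ occurs in $\mathbf v$; $H$ is a symmetry group isomorphic to $\mathbb Z_2\times\mathbb Z_2\times\mathbb Z_2$; $\mathcal L(\mathbf v)$ is closed under $H$; and $\mathbf v$ is $H$-rich. Moreover, for each $i\in\{0,1,2\}$, $H_i$ is a symmetry group of order $4$ contained in $H$, and $\mathbf v$ is $H_i$-rich. -/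

import Mathlib

namespace SymWords

variable {A B : Type*}

/-! ### Infinite words, factors, special factors -/

/-- The word `u_i u_{i+1} ⋯ u_{i+n-1}`. -/
def factorAt (u : ℕ → A) (i n : ℕ) : List A :=
  (List.range n).map fun j => u (i + j)

/-- The language of an infinite word: the set of all its (finite) factors. -/
def language (u : ℕ → A) : Set (List A) :=
  {w | ∃ i, w = factorAt u i w.length}

/-- Left extensions of `w` in `u`. -/
def leftExt (u : ℕ → A) (w : List A) : Set A := {a | a :: w ∈ language u}

/-- Right extensions of `w` in `u`. -/
def rightExt (u : ℕ → A) (w : List A) : Set A := {a | w ++ [a] ∈ language u}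

/-- A factor of `u` that is left special or right special (at least two left extensions, or at
least two right extensions). -/
def IsSpecial (u : ℕ → A) (w : List A) : Prop :=
  w ∈ language u ∧ ((leftExt u w).Nontrivial ∨ (rightExt u w).Nontrivial)

/-! ### Morphisms and antimorphisms -/

/-- `f` is a morphism of the free monoid of finite words. -/
def IsMorphism (f : List A → List A) : Prop := ∀ v w, f (v ++ w) = f v ++ f w

/-- `f` is an antimorphism of the free monoid of finite words. -/
def IsAntimorphism (f : List A → List A) : Prop := ∀ v w, f (v ++ w) = f w ++ f v

/-- The antimorphism determined by a map `σ` on letters. -/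
def antiExt (σ : A → A) (w : List A) : List A := (w.map σ).reverse

theorem antiExt_involutive {σ : A → A} (h : Function.Involutive σ) :
    Function.Involutive (antiExt σ) := by
  intro w
  simp [antiExt, List.map_reverse, h.comp_self]

/-- The image `f(u₀) f(u₁) f(u₂) ⋯` of an infinite word under the morphism determined by the
letter images `f`, for `f` non-erasing (its letter number `n` is read off from
`f(u₀) ⋯ f(u_n)`, which has at least `n + 1` letters). -/
def applyInf [Inhabited B] (f : A → List B) (u : ℕ → A) (n : ℕ) : B :=
  ((factorAt u 0 (n + 1)).flatMap f).getD n default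

/-- The groups of symmetries considered: finite groups of morphisms and antimorphisms containing
at least one antimorphism. -/
structure IsSymmetryGroup (G : Subgroup (Equiv.Perm (List A))) : Prop where
  morphism_or_antimorphism : ∀ ν ∈ G, IsMorphism ν ∨ IsAntimorphism ν
  finite : Finite G
  exists_antimorphism : ∃ Θ ∈ G, IsAntimorphism Θ

/-! ### Graphs of symmetries and richness -/

/-- The language of `u` is closed under `G`. -/
def ClosedUnder (G : Subgroup (Equiv.Perm (List A))) (u : ℕ → A) : Prop :=
  ∀ w ∈ language u, ∀ ν ∈ G, ν w ∈ language u

/-- The class `[w]` of words that are `G`-equivalent to `w`. -/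
def cls (G : Subgroup (Equiv.Perm (List A))) (w : List A) : Set (List A) :=
  {x | ∃ ν ∈ G, x = ν w}

/-- Vertices of the graphs of symmetries of order `n`: classes of special factors of length `n`. -/
def symVertices (G : Subgroup (Equiv.Perm (List A))) (u : ℕ → A) (n : ℕ) :
    Set (Set (List A)) :=
  {P | ∃ w, w.length = n ∧ IsSpecial u w ∧ P = cls G w}

/-- The edges of the directed graph of symmetries of order `n`: factors of `u` of length at least
`n + 1` in which special factors of length `n` occur exactly twice, as prefix and as suffix. -/
def IsDirectedEdge (u : ℕ → A) (n : ℕ) (e : List A) : Prop :=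
  e ∈ language u ∧ n + 1 ≤ e.length ∧
    IsSpecial u (e.take n) ∧ IsSpecial u (e.drop (e.length - n)) ∧
    ∀ i, 0 < i → i + n < e.length → ¬ IsSpecial u ((e.drop i).take n)

/-- The directed edge `e` starts in the vertex `P` and ends in the vertex `Q`. -/
def DirectedJoins (G : Subgroup (Equiv.Perm (List A))) (u : ℕ → A) (n : ℕ)
    (e : List A) (P Q : Set (List A)) : Prop :=
  IsDirectedEdge u n e ∧ P ∈ symVertices G u n ∧ Q ∈ symVertices G u n ∧
    e.take n ∈ P ∧ e.drop (e.length - n) ∈ Q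

/-- In the undirected graph of symmetries of order `n` (a multigraph whose edges are classes
`[e]` of directed edges), the edge `E` connects the vertices `P` and `Q`. -/
def Joins (G : Subgroup (Equiv.Perm (List A))) (u : ℕ → A) (n : ℕ)
    (E P Q : Set (List A)) : Prop :=
  ∃ e, E = cls G e ∧ (DirectedJoins G u n e P Q ∨ DirectedJoins G u n e Q P)

/-- The simple graph underlying the undirected graph of symmetries of order `n`. -/
def simpleSymGraph (G : Subgroup (Equiv.Perm (List A))) (u : ℕ → A) (n : ℕ) :
    SimpleGraph (symVertices G u n) where
  Adj P Q := P ≠ Q ∧ ∃ E, Joins G u n E P Q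
  symm := ⟨fun _ _ ⟨h, E, e, hE, he⟩ => ⟨h.symm, E, e, hE, he.symm⟩⟩
  loopless := ⟨fun _ h => h.1 rfl⟩

/-- After removal of its loops, the undirected graph of symmetries of order `n` is a tree: it has
no multiple edges, and the underlying simple graph is a tree. -/
def IsTreeWithoutLoops (G : Subgroup (Equiv.Perm (List A))) (u : ℕ → A) (n : ℕ) : Prop :=
  (∀ P Q, P ≠ Q → ∀ E E', Joins G u n E P Q → Joins G u n E' P Q → E = E') ∧
    (simpleSymGraph G u n).IsTree

/-- `e` is a `Θ`-palindrome for some antimorphism `Θ ∈ G`. -/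
def IsGPalindrome (G : Subgroup (Equiv.Perm (List A))) (e : List A) : Prop :=
  ∃ Θ ∈ G, IsAntimorphism Θ ∧ Θ e = e

/-- The tree-like structure property `G`-tls(`N`). -/
def PropertyTLS (G : Subgroup (Equiv.Perm (List A))) (N : ℕ) (u : ℕ → A) : Prop :=
  ∀ n, N ≤ n →
    ClosedUnder G u ∧
    (∀ e P, DirectedJoins G u n e P P → IsGPalindrome G e) ∧
    IsTreeWithoutLoops G u n

/-- `u` is `G`-rich. -/
def GRich (G : Subgroup (Equiv.Perm (List A))) (u : ℕ → A) : Prop := PropertyTLS G 1 u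

/-! ### The words `u` and `v` and the groups `H`, `H_i` -/

/-- Letter images of `φ`. -/
def phi : Fin 8 → List (Fin 8) :=
  ![[0, 1], [2], [6, 5], [4], [2, 3], [6], [4, 7], [0]]

/-- Letter images of `μ`. -/
def mu : Fin 8 → List (Fin 6) :=
  ![[1, 5], [0, 4], [1, 2], [0, 3], [0, 4], [1, 2], [0, 3], [1, 5]]

/-- The infinite word with prefixes `φ^k(0)`. -/
def wordU (n : ℕ) : Fin 8 :=
  ((fun w : List (Fin 8) => w.flatMap phi)^[n + 1] [0]).getD n 0

/-- `v = μ(u)`. -/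
def wordV : ℕ → Fin 6 := applyInf mu wordU

/-- The letter permutations of `Ψ₀, Ψ₁, Ψ₂`. -/
def psiLetter : Fin 3 → Fin 6 → Fin 6 :=
  ![![0, 1, 4, 5, 2, 3], ![1, 0, 2, 3, 4, 5], ![0, 1, 3, 2, 5, 4]]

theorem psiLetter_involutive : ∀ i, Function.Involutive (psiLetter i) := by
  unfold Function.Involutive
  decide

/-- The antimorphisms `Ψ₀, Ψ₁, Ψ₂`, as bijections of the set of finite words. -/
def Psi (i : Fin 3) : Equiv.Perm (List (Fin 6)) :=
  (antiExt_involutive (psiLetter_involutive i)).toPerm (antiExt (psiLetter i))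

/-- The group generated by `Ψ₀, Ψ₁, Ψ₂`. -/
def groupH : Subgroup (Equiv.Perm (List (Fin 6))) :=
  Subgroup.closure {Psi 0, Psi 1, Psi 2}

/-- The group generated by `Ψ_i` and `Ψ_{i+1 mod 3}` (addition in `Fin 3` is modulo 3). -/
def groupHi (i : Fin 3) : Subgroup (Equiv.Perm (List (Fin 6))) :=
  Subgroup.closure {Psi i, Psi (i + 1)}

end SymWords

/-!
The word `u` is a skew product over the Fibonacci word `f = abaababa⋯`: its letter number `n`
records `f n` together with the parities of the numbers of `a` and of `b` in the prefix of length
`n`. Through `μ`, the word `v` alternates between a letter `0` or `1`, which depends only on the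
parity of `n`, and one of the letters `2, 3, 4, 5`, which encodes the parity vector in `(ℤ/2)²`.
Consequently equal factors of `f` give factors of `v` that differ by one of the morphisms in `H`,
which act on parity vectors by translations (`act_factorAt_of_sameFactor`), and palindromes of `f`
give factors of `v` fixed by an antimorphism in `H`, which is determined by the parity vector of
the palindrome (`act_factorAt_of_isPal`).

The bispecial factors of `f` are palindromes `w_k` with `w_{k+1} = σ(w_k)a`, where `σ` is the
Fibonacci morphism `a ↦ ab, b ↦ a`, and they occur exactly at the positions of the blocks
`σ^k(f_j)`. If `|w_{k-1}| < m ≤ |w_k|`, then the special factors of length `m` are the prefix and the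
suffix of `w_k`. So each edge of the graphs of symmetries of `v` lies over `w_k` or over one of
the two complete returns to `w_k`, shortened equally at both ends, and these are palindromes. The
antimorphisms fixing the three corresponding factors of `v` are `Ψ₀, Ψ₁, Ψ₂` in some order: this
holds for `k = 0`, and passing from `k` to `k + 1` permutes the three cyclically
(`exists_parity_bispecial`).

The groups in question contain all of `Ψ₀, Ψ₁, Ψ₂` except at most one. An edge fixed by a `Ψ_i` in
the group is a palindromic loop. The edges fixed by the omitted `Ψ_i` form a single class, which
joins two different vertices, and there are no other vertices. If some `Ψ_i` is omitted but no
edge is fixed by it, then it fixes a special factor, and there is one vertex. If none is omitted,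
there is one vertex because `H` permutes the special factors of each length transitively. This is
`loops_and_tree_of_types`; its hypotheses are verified in `IsLevel.loops_and_tree`, and for
factors of length one in `loops_and_tree_one`.
-/

namespace SymWords

/-! ### Infinite words and morphisms -/

section General

variable {A B : Type*}

@[simp]
theorem length_factorAt (u : ℕ → A) (i n : ℕ) : (factorAt u i n).length = n := by
  simp [factorAt]

theorem getElem_factorAt (u : ℕ → A) (i n r : ℕ) (h : r < (factorAt u i n).length) :
    (factorAt u i n)[r] = u (i + r) := by
  simp [factorAt]

theorem factorAt_add (u : ℕ → A) (i m n : ℕ) :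
    factorAt u i (m + n) = factorAt u i m ++ factorAt u (i + m) n := by
  simp [factorAt, List.range_add, add_assoc]

theorem factorAt_one (u : ℕ → A) (i : ℕ) : factorAt u i 1 = [u i] := by
  simp [factorAt]

theorem factorAt_succ (u : ℕ → A) (i n : ℕ) :
    factorAt u i (n + 1) = factorAt u i n ++ [u (i + n)] := by
  rw [factorAt_add, factorAt_one]

theorem factorAt_succ' (u : ℕ → A) (i n : ℕ) :
    factorAt u i (n + 1) = u i :: factorAt u (i + 1) n := by
  rw [add_comm, factorAt_add, factorAt_one, List.singleton_append]

theorem factorAt_eq_iff {u w : ℕ → A} {i j n : ℕ} :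
    factorAt u i n = factorAt w j n ↔ ∀ r < n, u (i + r) = w (j + r) := by
  simp [factorAt]

theorem factorAt_mem_language (u : ℕ → A) (i n : ℕ) : factorAt u i n ∈ language u :=
  ⟨i, by simp⟩

theorem take_factorAt (u : ℕ → A) (i : ℕ) {m n : ℕ} (h : m ≤ n) :
    (factorAt u i n).take m = factorAt u i m := by
  obtain ⟨d, rfl⟩ := Nat.exists_eq_add_of_le h
  rw [factorAt_add, List.take_left' (by simp)]

theorem drop_factorAt (u : ℕ → A) (i m n : ℕ) :
    (factorAt u i (m + n)).drop m = factorAt u (i + m) n := by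
  rw [factorAt_add, List.drop_left' (by simp)]

theorem le_length_flatMap {g : A → List B} (hg : ∀ a, 1 ≤ (g a).length) (w : List A) :
    w.length ≤ (w.flatMap g).length := by
  induction w with
  | nil => simp
  | cons a w ih =>
    have := hg a
    simp only [List.flatMap_cons, List.length_cons, List.length_append]
    omega

theorem length_flatMap_succ (g : A → List B) (w : ℕ → A) (j : ℕ) :
    ((factorAt w 0 (j + 1)).flatMap g).length =
      ((factorAt w 0 j).flatMap g).length + (g (w j)).length := by
  simp [factorAt_succ]

/-- Extending the prefix of `w` does not change the letters already produced. -/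
theorem getD_flatMap_factorAt [Inhabited B] (g : A → List B) (w : ℕ → A) {j j' n : ℕ} (h : j ≤ j')
    (hn : n < ((factorAt w 0 j).flatMap g).length) :
    ((factorAt w 0 j').flatMap g).getD n default = ((factorAt w 0 j).flatMap g).getD n default := by
  obtain ⟨d, rfl⟩ := Nat.exists_eq_add_of_le h
  rw [factorAt_add, List.flatMap_append, List.getD_append _ _ _ _ hn]

/-- The image of the letter `w j` sits in `applyInf g w` right after the image of the prefix of
length `j`. -/
theorem applyInf_add [Inhabited B] {g : A → List B} (hg : ∀ a, 1 ≤ (g a).length) (w : ℕ → A)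
    (j r : ℕ) (hr : r < (g (w j)).length) :
    applyInf g w (((factorAt w 0 j).flatMap g).length + r) = (g (w j)).getD r default := by
  have hj := le_length_flatMap hg (factorAt w 0 j)
  rw [length_factorAt] at hj
  unfold applyInf
  rw [getD_flatMap_factorAt g w (j := j + 1) (by omega) (by rw [length_flatMap_succ]; omega),
    factorAt_succ, List.flatMap_append, List.getD_append_right _ _ _ _ (by omega)]
  simp

end General

/-! ### The fixed point of `φ` -/

theorem one_le_length_phi : ∀ c, 1 ≤ (phi c).length := by decide

/-- The words `φ^k(0)`. -/
def phiIter (k : ℕ) : List (Fin 8) := (fun w : List (Fin 8) => w.flatMap phi)^[k] [0]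

theorem phiIter_succ (k : ℕ) : phiIter (k + 1) = (phiIter k).flatMap phi :=
  Function.iterate_succ_apply' _ _ _

theorem phiIter_prefix_succ (k : ℕ) : phiIter k <+: phiIter (k + 1) := by
  induction k with
  | zero => decide
  | succ k ih =>
    obtain ⟨s, hs⟩ := ih
    exact ⟨s.flatMap phi, by rw [phiIter_succ k, phiIter_succ (k + 1), ← hs, List.flatMap_append]⟩

theorem phiIter_prefix {k l : ℕ} (h : k ≤ l) : phiIter k <+: phiIter l := by
  induction l, h using Nat.le_induction with
  | base => exact List.prefix_rfl
  | succ l _ ih => exact ih.trans (phiIter_prefix_succ l)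

theorem zero_mem_phiIter (k : ℕ) : 0 ∈ phiIter k := by
  induction k with
  | zero => decide
  | succ k ih =>
    rw [phiIter_succ]
    exact List.mem_flatMap.2 ⟨0, ih, by decide⟩

theorem length_flatMap_phi_gt (w : List (Fin 8)) (h : 0 ∈ w) :
    w.length < (w.flatMap phi).length := by
  induction w with
  | nil => simp at h
  | cons c w ih =>
    have h1 := one_le_length_phi c
    have h2 := le_length_flatMap one_le_length_phi w
    simp only [List.flatMap_cons, List.length_cons, List.length_append]
    rcases List.mem_cons.1 h with h | h
    · subst h
      have : (phi 0).length = 2 := by decide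
      omega
    · have := ih h
      omega

theorem lt_length_phiIter (k : ℕ) : k < (phiIter k).length := by
  induction k with
  | zero => decide
  | succ k ih =>
    have := length_flatMap_phi_gt _ (zero_mem_phiIter k)
    rw [phiIter_succ]
    omega

theorem wordU_eq_getD (k n : ℕ) (h : n < (phiIter k).length) : wordU n = (phiIter k).getD n 0 := by
  have h' : n < (phiIter (n + 1)).length := (Nat.lt_succ_self n).trans (lt_length_phiIter _)
  change (phiIter (n + 1)).getD n 0 = _
  rcases le_total k (n + 1) with hk | hk
  · obtain ⟨s, hs⟩ := phiIter_prefix hk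
    rw [← hs, List.getD_append _ _ _ _ h]
  · obtain ⟨s, hs⟩ := phiIter_prefix hk
    rw [← hs, List.getD_append _ _ _ _ h']

theorem factorAt_wordU_phiIter (k : ℕ) : factorAt wordU 0 (phiIter k).length = phiIter k := by
  refine List.ext_getElem (by simp) fun n h1 h2 => ?_
  rw [getElem_factorAt, zero_add, wordU_eq_getD k n h2, List.getD_eq_getElem _ _ h2]

theorem applyInf_phi_wordU : applyInf phi wordU = wordU := by
  funext n
  have h1 : n < (phiIter (n + 1)).length := (Nat.lt_succ_self n).trans (lt_length_phiIter _)
  have h2 := lt_length_phiIter n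
  have h3 : n < ((factorAt wordU 0 (phiIter n).length).flatMap phi).length := by
    rw [factorAt_wordU_phiIter, ← phiIter_succ]; exact h1
  have h4 : n < ((factorAt wordU 0 (n + 1)).flatMap phi).length := by
    have := le_length_flatMap one_le_length_phi (factorAt wordU 0 (n + 1))
    rw [length_factorAt] at this
    omega
  unfold applyInf
  rw [← getD_flatMap_factorAt phi wordU (j := n + 1) (j' := (phiIter n).length) (by omega) h4,
    factorAt_wordU_phiIter, ← phiIter_succ, wordU_eq_getD (n + 1) n h1]
  rfl

/-- A fixed point of `φ` starts with `0`, the only letter whose image starts with itself. Its first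
`n` letters then have an image longer than `n`, so they determine the next letter. -/
theorem applyInf_phi_eq_self_iff (w : ℕ → Fin 8) : applyInf phi w = w ↔ w = wordU := by
  refine ⟨fun hw => ?_, fun h => h ▸ applyInf_phi_wordU⟩
  have hw0 : w 0 = 0 := by
    have h := applyInf_add one_le_length_phi w 0 0 (one_le_length_phi _)
    rw [hw] at h
    have key : ∀ c : Fin 8, c = (phi c).getD 0 default → c = 0 := by decide
    exact key _ h
  funext n
  induction n using Nat.strong_induction_on with
  | _ n ih =>
    rcases Nat.eq_zero_or_pos n with rfl | hn
    · exact hw0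
    · have hf : factorAt w 0 n = factorAt wordU 0 n :=
        factorAt_eq_iff.2 fun r hr => by simpa using ih r hr
      have hlen : n < ((factorAt w 0 n).flatMap phi).length := by
        have h0 : 0 ∈ factorAt w 0 n := by
          obtain ⟨d, rfl⟩ := Nat.exists_eq_add_of_le hn
          rw [add_comm, Nat.succ_eq_add_one, zero_add, factorAt_succ', hw0]
          exact List.mem_cons_self
        simpa using length_flatMap_phi_gt _ h0
      rw [← hw, ← applyInf_phi_wordU]
      unfold applyInf
      rw [getD_flatMap_factorAt phi w (Nat.le_succ n) hlen,
        getD_flatMap_factorAt phi wordU (Nat.le_succ n) (hf ▸ hlen), hf]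

/-! ### The Fibonacci word underlying `u` -/

/-- The projection of the eight letters of `u` to the two letters of the Fibonacci word; `true`
stands for the letter `a` of the Fibonacci morphism `a ↦ ab, b ↦ a` and `false` for `b`. -/
def isA : Fin 8 → Bool := ![true, false, true, false, true, false, true, false]

/-- The second component of a letter of `u`: the letter `u n` records the Fibonacci letter at `n`
and the parities of the numbers of `a` and of `b` before `n`. -/
def parityLabel : Fin 8 → ZMod 2 × ZMod 2 :=
  ![(0, 0), (1, 0), (1, 1), (0, 1), (1, 0), (1, 1), (0, 1), (0, 0)]

/-- The contribution of a Fibonacci letter to the parity vector. -/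
def letterParity (b : Bool) : ZMod 2 × ZMod 2 := if b then (1, 0) else (0, 1)

/-- The Fibonacci word `abaababa⋯`. -/
def fib (n : ℕ) : Bool := isA (wordU n)

/-- The parities of the numbers of `a` and `b` in the prefix of length `n` of the Fibonacci
word. -/
def parity (n : ℕ) : ZMod 2 × ZMod 2 := parityLabel (wordU n)

/-- The position of the image of the letter number `j` when the Fibonacci word is cut into images
of letters under `a ↦ ab, b ↦ a`. -/
def blockPos (j : ℕ) : ℕ := ((factorAt wordU 0 j).flatMap phi).length

@[simp]
theorem blockPos_zero : blockPos 0 = 0 := rfl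

theorem length_phi : ∀ c, (phi c).length = if isA c then 2 else 1 := by decide

theorem blockPos_succ (j : ℕ) : blockPos (j + 1) = blockPos j + if fib j then 2 else 1 := by
  rw [blockPos, length_flatMap_succ, length_phi]; rfl

theorem blockPos_succ_of_true {j : ℕ} (h : fib j = true) : blockPos (j + 1) = blockPos j + 2 := by
  simp [blockPos_succ, h]

theorem blockPos_succ_of_false {j : ℕ} (h : fib j = false) :
    blockPos (j + 1) = blockPos j + 1 := by
  simp [blockPos_succ, h]

theorem blockPos_strictMono : StrictMono blockPos :=
  strictMono_nat_of_lt_succ fun j => by rw [blockPos_succ]; split <;> omega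

theorem wordU_blockPos (j : ℕ) : wordU (blockPos j) = (phi (wordU j)).getD 0 0 := by
  have h := applyInf_add one_le_length_phi wordU j 0 (one_le_length_phi _)
  rwa [applyInf_phi_wordU] at h

theorem wordU_blockPos_add_one {j : ℕ} (hj : fib j = true) :
    wordU (blockPos j + 1) = (phi (wordU j)).getD 1 0 := by
  have h := applyInf_add one_le_length_phi wordU j 1 (by
    rw [length_phi, show isA (wordU j) = true from hj]; decide)
  rwa [applyInf_phi_wordU] at h

theorem fib_zero : fib 0 = true := by decide

theorem fib_one : fib 1 = false := by decide

@[simp]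
theorem parity_zero : parity 0 = 0 := by decide

theorem fib_blockPos (j : ℕ) : fib (blockPos j) = true := by
  have : ∀ c, isA ((phi c).getD 0 0) = true := by decide
  rw [fib, wordU_blockPos, this]

theorem fib_blockPos_add_one {j : ℕ} (hj : fib j = true) : fib (blockPos j + 1) = false := by
  have : ∀ c, isA c = true → isA ((phi c).getD 1 0) = false := by decide
  rw [fib, wordU_blockPos_add_one hj, this _ hj]

/-- Every position lies in some block; a block has a second letter iff it is the image of
`a`. -/
theorem exists_blockPos (i : ℕ) : ∃ j, i = blockPos j ∨ fib j = true ∧ i = blockPos j + 1 := by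
  induction i with
  | zero => exact ⟨0, Or.inl rfl⟩
  | succ i ih =>
    obtain ⟨j, rfl | ⟨hj, rfl⟩⟩ := ih
    · rcases h : fib j with _ | _
      · exact ⟨j + 1, Or.inl (blockPos_succ_of_false h).symm⟩
      · exact ⟨j, Or.inr ⟨h, rfl⟩⟩
    · exact ⟨j + 1, Or.inl (blockPos_succ_of_true hj).symm⟩

theorem exists_blockPos_of_true {i : ℕ} (hi : fib i = true) : ∃ j, i = blockPos j := by
  obtain ⟨j, h | ⟨hj, rfl⟩⟩ := exists_blockPos i
  · exact ⟨j, h⟩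
  · simp [fib_blockPos_add_one hj] at hi

theorem exists_blockPos_of_false {i : ℕ} (hi : fib i = false) :
    ∃ j, fib j = true ∧ i = blockPos j + 1 := by
  obtain ⟨j, rfl | h⟩ := exists_blockPos i
  · simp [fib_blockPos] at hi
  · exact ⟨j, h⟩

theorem fib_succ_of_false {i : ℕ} (hi : fib i = false) : fib (i + 1) = true := by
  obtain ⟨j, hj, rfl⟩ := exists_blockPos_of_false hi
  have h := blockPos_succ_of_true hj
  rw [show blockPos j + 1 + 1 = blockPos (j + 1) by omega, fib_blockPos]

theorem le_blockPos (j : ℕ) : j ≤ blockPos j := blockPos_strictMono.le_apply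

theorem parity_succ (i : ℕ) : parity (i + 1) = parity i + letterParity (fib i) := by
  induction i using Nat.strong_induction_on with
  | _ i ih =>
    -- Inside the image of `a` both letters come from one letter; at the end of a block the
    -- claim follows from the claim for the two letters whose images meet there.
    have inner : ∀ c, isA c = true → parityLabel ((phi c).getD 1 0) =
        parityLabel ((phi c).getD 0 0) + letterParity (isA ((phi c).getD 0 0)) := by decide
    have boundA : ∀ c c', isA c = true → parityLabel c' = parityLabel c + letterParity (isA c) →
        parityLabel ((phi c').getD 0 0) =
          parityLabel ((phi c).getD 1 0) + letterParity (isA ((phi c).getD 1 0)) := by decide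
    have boundB : ∀ c c', isA c = false → parityLabel c' = parityLabel c + letterParity (isA c) →
        parityLabel ((phi c').getD 0 0) =
          parityLabel ((phi c).getD 0 0) + letterParity (isA ((phi c).getD 0 0)) := by decide
    obtain ⟨j, rfl | ⟨hj, rfl⟩⟩ := exists_blockPos i
    · rcases h : fib j with _ | _
      · rw [parity, ← blockPos_succ_of_false h, parity, fib, wordU_blockPos, wordU_blockPos]
        refine boundB _ _ h (ih j ?_)
        rcases Nat.eq_zero_or_pos j with rfl | hj
        · simp [fib_zero] at h
        · have h1 : blockPos 1 = 2 := by decide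
          have := blockPos_strictMono.add_le_nat (j - 1) 1
          rw [Nat.sub_add_cancel hj] at this
          omega
      · rw [parity, parity, fib, wordU_blockPos, wordU_blockPos_add_one h]
        exact inner _ h
    · rw [parity, parity, fib, show blockPos j + 1 + 1 = blockPos (j + 1) by
        rw [blockPos_succ_of_true hj], wordU_blockPos, wordU_blockPos_add_one hj]
      exact boundA _ _ hj (ih j (Nat.lt_succ_of_le (le_blockPos j)))

/-- The action of the Fibonacci morphism on parity vectors. -/
def parityStep (t : ZMod 2 × ZMod 2) : ZMod 2 × ZMod 2 := (t.1 + t.2, t.1)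

theorem parity_blockPos (j : ℕ) : parity (blockPos j) = parityStep (parity j) := by
  have : ∀ c, parityLabel ((phi c).getD 0 0) = parityStep (parityLabel c) := by decide
  rw [parity, wordU_blockPos, this, parity]

theorem parity_blockPos_add_one (j : ℕ) :
    parity (blockPos j + 1) = parityStep (parity j) + (1, 0) := by
  rw [parity_succ, fib_blockPos, parity_blockPos]; rfl

/-! ### Repetitions and palindromes in the Fibonacci word -/

/-- The factors of length `l` of the Fibonacci word at the positions `i` and `i'` agree. -/
def SameFactor (i i' l : ℕ) : Prop := ∀ r < l, fib (i + r) = fib (i' + r)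

theorem SameFactor.symm {i i' l : ℕ} (h : SameFactor i i' l) : SameFactor i' i l :=
  fun r hr => (h r hr).symm

theorem SameFactor.trans {i i' i'' l : ℕ} (h : SameFactor i i' l) (h' : SameFactor i' i'' l) :
    SameFactor i i'' l :=
  fun r hr => (h r hr).trans (h' r hr)

theorem SameFactor.mono {i i' l l' : ℕ} (h : SameFactor i i' l) (hl : l' ≤ l) :
    SameFactor i i' l' :=
  fun r hr => h r (hr.trans_le hl)

theorem SameFactor.blockPos_add {i i' l : ℕ} (h : SameFactor i i' l) {r : ℕ} (hr : r ≤ l) :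
    blockPos (i + r) + blockPos i' = blockPos (i' + r) + blockPos i := by
  induction r with
  | zero => simp [add_comm]
  | succ r ih =>
    have h1 := ih (by omega)
    have h2 := h r (by omega)
    rw [← add_assoc, ← add_assoc, blockPos_succ, blockPos_succ, h2]
    omega

/-- Equal factors have equal images, each followed by the letter `a` of the next block. -/
theorem SameFactor.lift {i i' l L : ℕ} (h : SameFactor i i' l)
    (hL : blockPos i + L = blockPos (i + l) + 1) :
    SameFactor (blockPos i) (blockPos i') L := by
  intro r hr
  obtain ⟨j, hj⟩ := exists_blockPos (blockPos i + r)
  have hij : i ≤ j := by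
    by_contra hlt
    have := blockPos_strictMono.monotone (show j + 1 ≤ i by omega)
    rw [blockPos_succ] at this
    rcases hj with hj | ⟨hj, hj'⟩
    · split at this <;> omega
    · simp only [hj, if_true] at this; omega
  have hjl : j ≤ i + l := by
    by_contra hlt
    have := blockPos_strictMono (show i + l < j by omega)
    omega
  obtain ⟨d, rfl⟩ := Nat.exists_eq_add_of_le hij
  have hd := h.blockPos_add (show d ≤ l by omega)
  rcases hj with hj | ⟨hj, hj'⟩
  · rw [hj, show blockPos i' + r = blockPos (i' + d) by omega, fib_blockPos, fib_blockPos]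
  · have hdl : d < l := by
      rcases Nat.lt_or_ge d l with h | h
      · exact h
      · have : d = l := by omega
        subst this
        omega
    rw [hj', show blockPos i' + r = blockPos (i' + d) + 1 by omega, fib_blockPos_add_one hj,
      fib_blockPos_add_one ((h d hdl).symm.trans hj)]

/-- The factor of the Fibonacci word at the positions `s, …, t - 1` is a palindrome. -/
def IsPal (s t : ℕ) : Prop := ∀ r r', s ≤ r → r < t → r + r' + 1 = s + t → fib r = fib r'

theorem IsPal.blockPos_add {s t : ℕ} (h : IsPal s t) (d : ℕ) (hd : s + d ≤ t) :
    blockPos (s + d) + blockPos (t - d) = blockPos s + blockPos t := by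
  induction d with
  | zero => simp
  | succ d ih =>
    have h1 := ih (by omega)
    have h2 := h (s + d) (t - (d + 1)) (by omega) (by omega) (by omega)
    rw [show t - d = t - (d + 1) + 1 by omega, blockPos_succ, ← h2] at h1
    rw [← add_assoc, blockPos_succ]
    omega

/-- If `q` is a palindrome, then so is its image followed by `a`. -/
theorem IsPal.lift {s t : ℕ} (h : IsPal s t) : IsPal (blockPos s) (blockPos t + 1) := by
  intro y y' hs ht hy
  obtain ⟨j, hj⟩ := exists_blockPos y
  have hsj : s ≤ j := by
    by_contra hlt
    have := blockPos_strictMono.monotone (show j + 1 ≤ s by omega)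
    rw [blockPos_succ] at this
    rcases hj with hj | ⟨hj, hj'⟩
    · split at this <;> omega
    · simp only [hj, if_true] at this; omega
  have hjt : j ≤ t := by
    by_contra hlt
    have := blockPos_strictMono (show t < j by omega)
    omega
  obtain ⟨d, rfl⟩ := Nat.exists_eq_add_of_le hsj
  have hd := h.blockPos_add d hjt
  rcases hj with rfl | ⟨hj, rfl⟩
  · rw [show y' = blockPos (t - d) by omega, fib_blockPos, fib_blockPos]
  · have hdt : s + d < t := by
      rcases Nat.lt_or_ge (s + d) t with h | h
      · exact h
      · have : s + d = t := by omega
        rw [this] at ht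
        omega
    have h1 := h (s + d) (t - (d + 1)) (by omega) hdt (by omega)
    have h2 := blockPos_succ_of_true (h1.symm.trans hj)
    rw [show t - (d + 1) + 1 = t - d by omega] at h2
    rw [fib_blockPos_add_one hj, show y' = blockPos (t - (d + 1)) + 1 by omega,
      fib_blockPos_add_one (h1.symm.trans hj)]

theorem parity_add_parity_of_isPal {s t : ℕ} (h : IsPal s t) (d : ℕ) (hd : s + d ≤ t) :
    parity (s + d) + parity (t - d) = parity s + parity t := by
  induction d with
  | zero => simp
  | succ d ih =>
    have h1 := ih (by omega)
    have h2 := h (s + d) (t - (d + 1)) (by omega) (by omega) (by omega)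
    have key : ∀ a b c e : ZMod 2 × ZMod 2, a + (b + e) = c → a + e + b = c := by
      intro a b c e h; rw [← h]; abel
    rw [show t - d = t - (d + 1) + 1 by omega, parity_succ, ← h2] at h1
    rw [← add_assoc, parity_succ]
    exact key _ _ _ _ h1

/-! ### Bispecial factors of the Fibonacci word -/

/-- The positions `iterPos k 0 < iterPos k 1 < ⋯` of the blocks of the `k`-th power of the
Fibonacci morphism. These are the occurrences of the bispecial factor number `k`. -/
def iterPos (k j : ℕ) : ℕ := blockPos^[k] j

/-- The length of the bispecial factor number `k`: if `w` is bispecial, then the next bispecial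
factor is the image of `w` followed by `a`. -/
def bispLen : ℕ → ℕ
  | 0 => 0
  | k + 1 => blockPos (bispLen k) + 1

@[simp]
theorem iterPos_zero_left (j : ℕ) : iterPos 0 j = j := rfl

theorem iterPos_succ (k j : ℕ) : iterPos (k + 1) j = blockPos (iterPos k j) :=
  Function.iterate_succ_apply' _ _ _

theorem iterPos_succ' (k j : ℕ) : iterPos (k + 1) j = iterPos k (blockPos j) :=
  Function.iterate_succ_apply _ _ _

theorem iterPos_strictMono (k : ℕ) : StrictMono (iterPos k) := blockPos_strictMono.iterate k

@[simp]
theorem iterPos_zero (k : ℕ) : iterPos k 0 = 0 := by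
  induction k with
  | zero => rfl
  | succ k ih => rw [iterPos_succ, ih, blockPos_zero]

theorem bispLen_lt_succ (k : ℕ) : bispLen k < bispLen (k + 1) :=
  Nat.lt_succ_of_le (le_blockPos _)

theorem bispLen_strictMono : StrictMono bispLen := strictMono_nat_of_lt_succ bispLen_lt_succ

theorem sameFactor_iterPos (k j j' : ℕ) : SameFactor (iterPos k j) (iterPos k j') (bispLen k) := by
  suffices h : ∀ j, SameFactor 0 (iterPos k j) (bispLen k) from (h j).symm.trans (h j')
  intro j
  induction k with
  | zero => intro r hr; simp [bispLen] at hr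
  | succ k ih =>
    rw [iterPos_succ]
    exact ih.lift (by simp [bispLen])

theorem blockPos_iterPos_add (k j : ℕ) :
    blockPos (iterPos k j + bispLen k) = blockPos (iterPos k j) + blockPos (bispLen k) := by
  have h := (sameFactor_iterPos k j 0).blockPos_add le_rfl
  simp only [iterPos_zero, blockPos_zero, zero_add] at h
  omega

theorem iterPos_succ_add (k j : ℕ) :
    iterPos (k + 1) j + bispLen (k + 1) = blockPos (iterPos k j + bispLen k) + 1 := by
  rw [iterPos_succ, bispLen, blockPos_iterPos_add]; ring

/-- The return coded by `a` to the bispecial factor number `k` completes it to the next one. -/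
theorem iterPos_add_of_true {j : ℕ} (k : ℕ) (hj : fib j = true) :
    iterPos k j + bispLen (k + 1) = iterPos k (j + 1) + bispLen k := by
  induction k with
  | zero => simp [bispLen]
  | succ k ih =>
    obtain ⟨j', rfl⟩ := exists_blockPos_of_true hj
    have h := blockPos_iterPos_add (k + 1) j'
    rw [iterPos_succ' k] at h
    rw [iterPos_succ_add, ← ih, h, iterPos_succ, bispLen]
    ring

/-- Complete returns to a bispecial factor with the same coding letter are equal. -/
theorem sameFactor_return {j j' : ℕ} (k : ℕ) (h : fib j = fib j') {L : ℕ}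
    (hL : iterPos k j + L = iterPos k (j + 1) + bispLen k) :
    SameFactor (iterPos k j) (iterPos k j') L ∧
      iterPos k j' + L = iterPos k (j' + 1) + bispLen k := by
  induction k generalizing L with
  | zero =>
    obtain rfl : L = 1 := by simp [bispLen] at hL; omega
    refine ⟨fun r hr => ?_, by simp [bispLen]⟩
    obtain rfl : r = 0 := by omega
    exact h
  | succ k ih =>
    have hmono := (iterPos_strictMono k).monotone (Nat.le_succ j)
    obtain ⟨l, hl⟩ : ∃ l, iterPos k j + l = iterPos k (j + 1) + bispLen k :=
      ⟨iterPos k (j + 1) + bispLen k - iterPos k j, by simp at hmono; omega⟩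
    obtain ⟨h1, h2⟩ := ih hl
    rw [iterPos_succ_add, iterPos_succ] at hL ⊢
    rw [← hl] at hL
    refine ⟨(iterPos_succ k j').symm ▸ h1.lift hL, ?_⟩
    rw [← h2, iterPos_succ]
    have := h1.blockPos_add le_rfl
    omega

theorem isPal_iterPos (k j : ℕ) : IsPal (iterPos k j) (iterPos k j + bispLen k) := by
  induction k with
  | zero => intro r r' h1 h2; simp [bispLen] at h2; simp at h1; omega
  | succ k ih => rw [iterPos_succ_add, iterPos_succ]; exact ih.lift

theorem isPal_return (k j : ℕ) : IsPal (iterPos k j) (iterPos k (j + 1) + bispLen k) := by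
  induction k with
  | zero =>
    intro r r' h1 h2 h3
    simp only [iterPos_zero_left, bispLen] at *
    rw [show r = r' by omega]
  | succ k ih => rw [iterPos_succ_add, iterPos_succ]; exact ih.lift

/-- The letter following an occurrence of a bispecial factor is determined by the coding letter
of the next return, up to the exchange of letters. -/
theorem fib_after_eq_iff (k j j' : ℕ) :
    fib (iterPos k j + bispLen k) = fib (iterPos k j' + bispLen k) ↔ fib j = fib j' := by
  suffices h : ∀ j, (fib (iterPos k j + bispLen k) = xor (fib j) (k.bodd)) by
    rw [h, h]; exact Bool.xor_left_inj
  intro j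
  induction k with
  | zero => simp [bispLen]
  | succ k ih =>
    rw [iterPos_succ_add, Nat.bodd_succ]
    rcases h : fib (iterPos k j + bispLen k) with _ | _
    · rw [← blockPos_succ_of_false h, fib_blockPos]
      rw [h] at ih; revert ih; cases fib j <;> cases k.bodd <;> simp
    · rw [fib_blockPos_add_one h]
      rw [h] at ih; revert ih; cases fib j <;> cases k.bodd <;> simp

/-- The letter preceding an occurrence of a bispecial factor is determined by the coding letter
of the previous return, up to the exchange of letters. -/
theorem fib_before_eq_iff {k j j' i i' : ℕ} (hi : i + 1 = iterPos k (j + 1))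
    (hi' : i' + 1 = iterPos k (j' + 1)) : fib i = fib i' ↔ fib j = fib j' := by
  suffices h : ∀ i j, i + 1 = iterPos k (j + 1) → (fib i = xor (fib j) (k.bodd)) by
    rw [h _ _ hi, h _ _ hi']; exact Bool.xor_left_inj
  clear hi hi'
  induction k with
  | zero =>
    intro i j h
    obtain rfl : i = j := by simpa using h
    simp
  | succ k ih =>
    intro i j h
    obtain ⟨y, hy⟩ : ∃ y, y + 1 = iterPos k (j + 1) := by
      have := iterPos_strictMono k (Nat.succ_pos j)
      simp only [iterPos_zero, Nat.succ_eq_add_one] at this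
      exact ⟨iterPos k (j + 1) - 1, by omega⟩
    have ih := ih y j hy
    rw [iterPos_succ, ← hy] at h
    rw [Nat.bodd_succ]
    rcases hf : fib y with _ | _
    · rw [blockPos_succ_of_false hf] at h
      rw [show i = blockPos y by omega, fib_blockPos]
      rw [hf] at ih; revert ih; cases fib j <;> cases k.bodd <;> simp
    · rw [blockPos_succ_of_true hf] at h
      rw [show i = blockPos y + 1 by omega, fib_blockPos_add_one hf]
      rw [hf] at ih; revert ih; cases fib j <;> cases k.bodd <;> simp

theorem mem_range_iterPos_succ {k j : ℕ} (hj : fib j = true) :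
    ∃ j', iterPos k j = iterPos (k + 1) j' := by
  obtain ⟨j', rfl⟩ := exists_blockPos_of_true hj
  exact ⟨j', (iterPos_succ' k j').symm⟩

/-- A prefix longer than all bispecial factors before number `k` occurs only at the occurrences
of the bispecial factor number `k`. -/
theorem eq_iterPos_of_sameFactor {k m i : ℕ} (hm : ∀ k' < k, bispLen k' < m)
    (h : SameFactor i 0 m) : ∃ j, i = iterPos k j := by
  induction k with
  | zero => exact ⟨i, rfl⟩
  | succ k ih =>
    obtain ⟨j, rfl⟩ := ih fun k' hk' => hm k' (by omega)
    have h1 := h _ (hm k (Nat.lt_succ_self k))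
    have h2 := (fib_after_eq_iff k j 0).1 (by simpa using h1)
    exact mem_range_iterPos_succ (h2.trans fib_zero)

theorem exists_succ_of_iterPos_pos {k j i : ℕ} (h : i + 1 = iterPos k j) : ∃ j', j = j' + 1 := by
  refine Nat.exists_eq_add_one.2 (Nat.pos_of_ne_zero ?_)
  rintro rfl
  simp at h

/-- The mirror image of `eq_iterPos_of_sameFactor`, for suffixes of the bispecial factors. -/
theorem add_eq_iterPos_add_of_sameFactor {k m i a j₀ : ℕ} (hm : ∀ k' < k, bispLen k' < m)
    (ha : a + m = iterPos k j₀ + bispLen k) (h : SameFactor i a m) :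
    ∃ j, i + m = iterPos k j + bispLen k := by
  induction k generalizing j₀ with
  | zero => exact ⟨i + m, by simp [bispLen]⟩
  | succ k ih =>
    have h0 := iterPos_add_of_true k (fib_blockPos j₀)
    rw [iterPos_succ', h0] at ha
    obtain ⟨j, hj⟩ := ih (fun k' hk' => hm k' (by omega)) ha
    have hmk := hm k (Nat.lt_succ_self k)
    -- The letter in front of the final occurrence of the bispecial factor number `k`.
    have h1 := h (m - 1 - bispLen k) (by omega)
    have hi : i + (m - 1 - bispLen k) + 1 = iterPos k j := by omega
    have ha' : a + (m - 1 - bispLen k) + 1 = iterPos k (blockPos j₀ + 1) := by omega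
    obtain ⟨j, rfl⟩ := exists_succ_of_iterPos_pos hi
    have h2 := ((fib_before_eq_iff hi ha').1 h1).trans (fib_blockPos _)
    obtain ⟨j', hj'⟩ := mem_range_iterPos_succ (k := k) h2
    exact ⟨j', by rw [hj, ← iterPos_add_of_true k h2, hj']⟩

/-- A factor with two left extensions is a prefix of a bispecial factor. -/
theorem eq_iterPos_of_fib_ne_before {k m i i' : ℕ} (hm : ∀ k' < k, bispLen k' < m)
    (h : SameFactor (i + 1) (i' + 1) m) (hne : fib i ≠ fib i') : ∃ j, i + 1 = iterPos k j := by
  induction k generalizing i i' with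
  | zero => exact ⟨i + 1, rfl⟩
  | succ k ih =>
    obtain ⟨j, hj⟩ := ih (fun k' hk' => hm k' (by omega)) h hne
    obtain ⟨j', hj'⟩ := ih (fun k' hk' => hm k' (by omega)) h.symm hne.symm
    have h1 := h _ (hm k (Nat.lt_succ_self k))
    rw [hj, hj', fib_after_eq_iff] at h1
    rcases hf : fib j with _ | _
    · -- A return coded by `b` is preceded by one coded by `a`, which fixes the letter in front.
      exfalso
      obtain ⟨j, rfl⟩ := exists_succ_of_iterPos_pos hj
      obtain ⟨j', rfl⟩ := exists_succ_of_iterPos_pos hj'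
      have key : ∀ j, fib (j + 1) = false → fib j = true := by
        intro j hj
        by_contra hc
        rw [fib_succ_of_false (by simpa using hc)] at hj
        exact Bool.noConfusion hj
      exact hne ((fib_before_eq_iff hj hj').2 ((key _ hf).trans (key _ (h1 ▸ hf)).symm))
    · exact hj ▸ mem_range_iterPos_succ hf

/-- A factor with two right extensions is a suffix of a bispecial factor. -/
theorem add_eq_iterPos_add_of_fib_ne_after {k m i i' : ℕ} (hm : ∀ k' < k, bispLen k' < m)
    (h : SameFactor i i' m) (hne : fib (i + m) ≠ fib (i' + m)) :
    ∃ j, i + m = iterPos k j + bispLen k := by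
  induction k generalizing i i' with
  | zero => exact ⟨i + m, by simp [bispLen]⟩
  | succ k ih =>
    obtain ⟨j, hj⟩ := ih (fun k' hk' => hm k' (by omega)) h hne
    obtain ⟨j', hj'⟩ := ih (fun k' hk' => hm k' (by omega)) h.symm hne.symm
    have hmk := hm k (Nat.lt_succ_self k)
    have h1 := h (m - 1 - bispLen k) (by omega)
    have hi : i + (m - 1 - bispLen k) + 1 = iterPos k j := by omega
    have hi' : i' + (m - 1 - bispLen k) + 1 = iterPos k j' := by omega
    obtain ⟨j, rfl⟩ := exists_succ_of_iterPos_pos hi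
    obtain ⟨j', rfl⟩ := exists_succ_of_iterPos_pos hi'
    have h2 := (fib_before_eq_iff hi hi').1 h1
    rcases hf : fib j with _ | _
    · refine absurd ?_ hne
      rw [hj, hj', fib_after_eq_iff, fib_succ_of_false hf, fib_succ_of_false (h2 ▸ hf)]
    · obtain ⟨j₁, hj₁⟩ := mem_range_iterPos_succ (k := k) hf
      exact ⟨j₁, by rw [hj, ← iterPos_add_of_true k hf, hj₁]⟩

/-- Distances of consecutive occurrences of the bispecial factor number `k` exceed its excess
length over the previous bispecial factors. -/
theorem bispLen_add_iterPos_lt {k m : ℕ} (hm : ∀ k' < k, bispLen k' < m) (j : ℕ) :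
    bispLen k + iterPos k j < m + iterPos k (j + 1) := by
  cases k with
  | zero => simp [bispLen]; omega
  | succ k =>
    have h1 := iterPos_add_of_true k (fib_blockPos j)
    have h2 := (iterPos_strictMono k).monotone
      (Nat.succ_le_of_lt (blockPos_strictMono (Nat.lt_succ_self j)))
    have h3 := hm k (Nat.lt_succ_self k)
    rw [iterPos_succ', iterPos_succ']
    simp only [Nat.succ_eq_add_one] at h2
    omega

/-- The parity vectors attached to the antimorphisms `Ψ₀, Ψ₁, Ψ₂`. -/
def antiParity : Fin 3 → ZMod 2 × ZMod 2 := ![(0, 1), (0, 0), (1, 0)]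

/-- The parity vectors of a bispecial factor and of its two complete returns are the three values
of `antiParity`; passing to the next bispecial factor permutes them cyclically. -/
theorem exists_parity_bispecial (k : ℕ) : ∃ i : Fin 3, ∀ j,
    parity (iterPos k j) + parity (iterPos k j + bispLen k) = antiParity (i + 1) ∧
    parity (iterPos k j) + parity (iterPos k (j + 1) + bispLen k) =
      antiParity (if fib j then i + 2 else i) := by
  have double : ∀ a : ZMod 2 × ZMod 2, a + a = 0 := by decide
  induction k with
  | zero =>
    refine ⟨0, fun j => ?_⟩
    simp only [iterPos_zero_left, bispLen, add_zero, parity_succ, ← add_assoc, double, zero_add]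
    cases fib j <;> decide
  | succ k ih =>
    obtain ⟨i, hi⟩ := ih
    refine ⟨i + 1, fun j => ?_⟩
    have step : ∀ (s t : ZMod 2 × ZMod 2) (i : Fin 3), s + t = antiParity i →
        parityStep s + (parityStep t + (1, 0)) = antiParity (i + 1) := by
      have linear : ∀ s t, parityStep s + (parityStep t + (1, 0)) =
          parityStep (s + t) + (1, 0) := by decide
      have shift : ∀ i, parityStep (antiParity i) + (1, 0) = antiParity (i + 1) := by decide
      intro s t i h
      rw [linear, h, shift]
    rw [iterPos_succ_add, iterPos_succ_add, iterPos_succ, parity_blockPos, parity_blockPos_add_one,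
      parity_blockPos_add_one]
    refine ⟨step _ _ _ (hi j).1, (step _ _ _ (hi j).2).trans ?_⟩
    congr 1
    have : ∀ i : Fin 3, i + 2 + 1 = i + 1 + 2 := by decide
    cases fib j <;> simp [this]

/-- The occurrences of a bispecial factor carry all parity vectors. -/
theorem exists_parity_iterPos_eq (k : ℕ) (t : ZMod 2 × ZMod 2) : ∃ j, parity (iterPos k j) = t := by
  induction k generalizing t with
  | zero =>
    have : ∀ t, t = parity 0 ∨ t = parity 1 ∨ t = parity 2 ∨ t = parity 3 := by decide
    rcases this t with rfl | rfl | rfl | rfl <;> exact ⟨_, rfl⟩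
  | succ k ih =>
    have : ∀ t, ∃ s, parityStep s = t := by decide
    obtain ⟨s, rfl⟩ := this t
    obtain ⟨j, rfl⟩ := ih s
    exact ⟨j, by rw [iterPos_succ, parity_blockPos]⟩

/-! ### The symmetries of the word `v` -/

/-- The letter at an even position of `v`, in terms of the parity of half the position. -/
def evenLetter (z : ZMod 2) : Fin 6 := if z = 0 then 1 else 0

/-- The letter at an odd position of `v`, in terms of the parity vector. -/
def oddLetter (t : ZMod 2 × ZMod 2) : Fin 6 :=
  if t = (0, 0) then 5 else if t = (1, 0) then 4 else if t = (0, 1) then 3 else 2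

theorem length_mu : ∀ c, (mu c).length = 2 := by decide

theorem length_flatMap_mu (j : ℕ) : ((factorAt wordU 0 j).flatMap mu).length = 2 * j := by
  induction j with
  | zero => rfl
  | succ j ih => rw [length_flatMap_succ, ih, length_mu]; ring

theorem wordV_add (j r : ℕ) (hr : r < 2) : wordV (2 * j + r) = (mu (wordU j)).getD r 0 := by
  have h := applyInf_add (g := mu) (fun a => by rw [length_mu]; decide) wordU j r
    (by rw [length_mu]; exact hr)
  rwa [length_flatMap_mu] at h

theorem parity_fst_add_snd (j : ℕ) : (parity j).1 + (parity j).2 = (j : ZMod 2) := by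
  induction j with
  | zero => simp
  | succ j ih =>
    have : ∀ b, (letterParity b).1 + (letterParity b).2 = 1 := by decide
    rw [parity_succ, Prod.fst_add, Prod.snd_add, add_add_add_comm, this, ih]
    push_cast
    rfl

theorem wordV_even (j : ℕ) : wordV (2 * j) = evenLetter j := by
  have : ∀ c, (mu c).getD 0 0 = evenLetter ((parityLabel c).1 + (parityLabel c).2) := by decide
  have h := wordV_add j 0 (by decide)
  rwa [this, ← parity, parity_fst_add_snd, add_zero] at h

theorem wordV_odd (j : ℕ) : wordV (2 * j + 1) = oddLetter (parity j) := by
  have : ∀ c, (mu c).getD 1 0 = oddLetter (parityLabel c) := by decide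
  rw [wordV_add j 1 (by decide), this, parity]

theorem oddLetter_injective : Function.Injective oddLetter := by
  unfold Function.Injective
  decide

theorem evenLetter_ne_oddLetter : ∀ z t, evenLetter z ≠ oddLetter t := by decide

/-- Exponent vectors: `(a, b, c)` stands for the symmetry `Ψ₀ ^ a * Ψ₁ ^ b * Ψ₂ ^ c`. -/
abbrev SymIndex : Type := ZMod 2 × ZMod 2 × ZMod 2

/-- The permutation of letters underlying a symmetry. -/
def letterAct (q : SymIndex) (c : Fin 6) : Fin 6 :=
  (if q.1 = 1 then psiLetter 0 else id)
    ((if q.2.1 = 1 then psiLetter 1 else id) ((if q.2.2 = 1 then psiLetter 2 else id) c))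

/-- The orientation of a symmetry: `0` for morphisms and `1` for antimorphisms. -/
def orient (q : SymIndex) : ZMod 2 := q.1 + q.2.1 + q.2.2

/-- The translation of parity vectors induced by a symmetry. -/
def shift (q : SymIndex) : ZMod 2 × ZMod 2 := (q.2.2, q.1)

/-- The exponent vectors of `Ψ₀, Ψ₁, Ψ₂`. -/
def gen : Fin 3 → SymIndex := ![(1, 0, 0), (0, 1, 0), (0, 0, 1)]

/-- The action of a symmetry on finite words. -/
def act (q : SymIndex) (w : List (Fin 6)) : List (Fin 6) :=
  if orient q = 0 then w.map (letterAct q) else (w.map (letterAct q)).reverse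

set_option maxRecDepth 4000 in
theorem letterAct_add : ∀ p q c, letterAct (p + q) c = letterAct p (letterAct q c) := by decide

theorem orient_add (p q : SymIndex) : orient (p + q) = orient p + orient q := by
  simp only [orient, Prod.fst_add, Prod.snd_add]; ring

theorem eq_sum_gen : ∀ q : SymIndex, q = (if q.1 = 1 then gen 0 else 0) +
    ((if q.2.1 = 1 then gen 1 else 0) + if q.2.2 = 1 then gen 2 else 0) := by decide

theorem orient_gen : ∀ i, orient (gen i) = 1 := by decide

theorem shift_gen : ∀ i, shift (gen i) = antiParity i := by decide

theorem letterAct_oddLetter : ∀ q t, letterAct q (oddLetter t) = oddLetter (t + shift q) := by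
  decide

theorem letterAct_evenLetter : ∀ q z, letterAct q (evenLetter z) =
    evenLetter (z + (orient q + (shift q).1 + (shift q).2)) := by
  decide

theorem ext_orient_shift : ∀ p q : SymIndex, orient p = orient q → shift p = shift q → p = q := by
  decide

theorem exists_orient_shift : ∀ s t, ∃ q : SymIndex, orient q = s ∧ shift q = t := by decide

theorem orient_eq : ∀ q, orient q = 0 ∨ orient q = 1 := by decide

theorem add_self_index : ∀ q : SymIndex, q + q = 0 := by decide

theorem act_of_orient_zero {q : SymIndex} (h : orient q = 0) (w : List (Fin 6)) :
    act q w = w.map (letterAct q) := if_pos h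

theorem act_of_orient_one {q : SymIndex} (h : orient q = 1) (w : List (Fin 6)) :
    act q w = (w.map (letterAct q)).reverse := if_neg (by rw [h]; decide)

theorem act_add (p q : SymIndex) (w : List (Fin 6)) : act (p + q) w = act p (act q w) := by
  have hpq := orient_add p q
  have hl : letterAct (p + q) = letterAct p ∘ letterAct q := funext (letterAct_add p q)
  rcases orient_eq p with hp | hp <;> rcases orient_eq q with hq | hq
  · rw [hp, hq] at hpq
    rw [act_of_orient_zero hpq, act_of_orient_zero hp, act_of_orient_zero hq, hl, List.map_map]
  · rw [hp, hq] at hpq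
    rw [act_of_orient_one hpq, act_of_orient_zero hp, act_of_orient_one hq, hl, List.map_reverse,
      List.map_map]
  · rw [hp, hq] at hpq
    rw [act_of_orient_one hpq, act_of_orient_one hp, act_of_orient_zero hq, hl, List.map_map]
  · rw [hp, hq] at hpq
    rw [act_of_orient_zero hpq, act_of_orient_one hp, act_of_orient_one hq, hl, List.map_reverse,
      List.reverse_reverse, List.map_map]

theorem act_zero (w : List (Fin 6)) : act 0 w = w := by
  have : letterAct 0 = id := funext (by decide)
  rw [act_of_orient_zero (by decide), this, List.map_id]

theorem act_act (q : SymIndex) (w : List (Fin 6)) : act q (act q w) = w := by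
  rw [← act_add, add_self_index, act_zero]

theorem act_comm (p q : SymIndex) (w : List (Fin 6)) : act p (act q w) = act q (act p w) := by
  rw [← act_add, add_comm, act_add]

theorem length_act (q : SymIndex) (w : List (Fin 6)) : (act q w).length = w.length := by
  unfold act; split <;> simp

theorem act_gen (i : Fin 3) (w : List (Fin 6)) : act (gen i) w = Psi i w := by
  have : ∀ i c, letterAct (gen i) c = psiLetter i c := by decide
  rw [act_of_orient_one (orient_gen i), funext (this i)]
  rfl

theorem isMorphism_act {q : SymIndex} (h : orient q = 0) : IsMorphism (act q) := fun v w => by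
  simp only [act_of_orient_zero h, List.map_append]

theorem isAntimorphism_act {q : SymIndex} (h : orient q = 1) : IsAntimorphism (act q) :=
  fun v w => by simp only [act_of_orient_one h, List.map_append, List.reverse_append]

theorem act_factorAt_of_orient_zero {q : SymIndex} (h : orient q = 0) {i i' n : ℕ} :
    act q (factorAt wordV i n) = factorAt wordV i' n ↔
      ∀ r < n, letterAct q (wordV (i + r)) = wordV (i' + r) := by
  rw [act_of_orient_zero h]
  simp [factorAt]

theorem act_factorAt_of_orient_one {q : SymIndex} (h : orient q = 1) {i i' n : ℕ} :
    act q (factorAt wordV i n) = factorAt wordV i' n ↔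
      ∀ r r', r + r' + 1 = n → letterAct q (wordV (i + r)) = wordV (i' + r') := by
  rw [act_of_orient_one h, List.ext_getElem_iff]
  simp only [List.length_reverse, List.length_map, length_factorAt, List.getElem_reverse,
    List.getElem_map, getElem_factorAt, true_and]
  constructor
  · intro H r r' hr
    have := H r' (by omega) (by omega)
    rwa [show n - 1 - r' = r by omega] at this
  · intro H r hr _
    exact H _ _ (by omega)

theorem SameFactor.parity_add {i i' l : ℕ} (h : SameFactor i i' l) {d : ℕ} (hd : d ≤ l) :
    parity (i' + d) = parity (i + d) + (parity i + parity i') := by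
  have double : ∀ a b : ZMod 2 × ZMod 2, b = a + (a + b) := by decide
  induction d with
  | zero => exact double _ _
  | succ d ih =>
    rw [← add_assoc i', ← add_assoc i, parity_succ, parity_succ, ih (by omega), h d (by omega)]
    abel

/-- Equal factors of the Fibonacci word give factors of `v` that differ by a morphism. -/
theorem act_factorAt_of_sameFactor {q : SymIndex} {i i' l : ℕ} (h : SameFactor i i' l)
    (hq : orient q = 0) (hs : shift q = parity i + parity i') {r n : ℕ} (hn : r + n ≤ 2 * l + 3) :
    act q (factorAt wordV (2 * i + r) n) = factorAt wordV (2 * i' + r) n := by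
  rw [act_factorAt_of_orient_zero hq]
  intro r' hr'
  have double : ∀ a b d : ZMod 2, a + d + (0 + (a + b)) = b + d := by decide
  rw [add_assoc, add_assoc]
  rcases Nat.even_or_odd' (r + r') with ⟨d, hd | hd⟩
  · rw [hd, ← mul_add, ← mul_add, wordV_even, wordV_even, letterAct_evenLetter, hq, hs]
    congr 1
    rw [add_assoc 0, Prod.fst_add, Prod.snd_add, add_add_add_comm, parity_fst_add_snd,
      parity_fst_add_snd]
    push_cast
    exact double _ _ _
  · rw [hd, ← add_assoc, ← add_assoc, ← mul_add, ← mul_add, wordV_odd, wordV_odd,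
      letterAct_oddLetter, hs, h.parity_add (by omega)]

/-- Palindromes of the Fibonacci word give factors of `v` fixed by an antimorphism. -/
theorem act_factorAt_of_isPal {q : SymIndex} {s t : ℕ} (h : IsPal s t)
    (hq : orient q = 1) (hs : shift q = parity s + parity t) {i i' n : ℕ} (hi : 2 * s ≤ i)
    (hi' : i + n ≤ 2 * t + 3) (hn : i + i' + n = 2 * s + 2 * t + 3) :
    act q (factorAt wordV i n) = factorAt wordV i' n := by
  rw [act_factorAt_of_orient_one hq]
  intro r r' hr
  rcases Nat.even_or_odd' (i + r) with ⟨j, hj | hj⟩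
  · obtain ⟨j', hj', hjj⟩ : ∃ j', i' + r' = 2 * j' ∧ j + j' = s + t + 1 :=
      ⟨s + t + 1 - j, by omega, by omega⟩
    rw [hj, hj', wordV_even, wordV_even, letterAct_evenLetter, hq, hs, add_assoc 1, Prod.fst_add,
      Prod.snd_add, add_add_add_comm, parity_fst_add_snd, parity_fst_add_snd]
    congr 1
    have hc : (j : ZMod 2) + j' = s + t + 1 := by
      exact_mod_cast congrArg (Nat.cast (R := ZMod 2)) hjj
    have : ∀ a b c d : ZMod 2, a + b = c + d + 1 → a + (1 + (c + d)) = b := by decide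
    exact this _ _ _ _ hc
  · obtain ⟨d, rfl⟩ := Nat.exists_eq_add_of_le (show s ≤ j by omega)
    have hd : i' + r' = 2 * (t - d) + 1 := by omega
    rw [hj, hd, wordV_odd, wordV_odd, letterAct_oddLetter, hs,
      ← parity_add_parity_of_isPal h d (by omega)]
    have : ∀ a b : ZMod 2 × ZMod 2, a + (a + b) = b := by decide
    rw [this]

/-- The language of `v` is closed under all symmetries: a factor sits inside a long bispecial
factor, which is a palindrome and occurs with every parity vector. -/
theorem act_mem_language (q : SymIndex) {w : List (Fin 6)} (hw : w ∈ language wordV) :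
    act q w ∈ language wordV := by
  have main : ∀ q, orient q = 0 → ∀ w ∈ language wordV, act q w ∈ language wordV := by
    rintro q hq w ⟨i, hi⟩
    rw [hi]
    have hk := bispLen_strictMono.le_apply (x := i + w.length)
    obtain ⟨j, hj⟩ := exists_parity_iterPos_eq (i + w.length) (shift q)
    have h := act_factorAt_of_sameFactor (sameFactor_iterPos (i + w.length) 0 j) hq (r := i)
      (n := w.length) (by simp [hj]) (by omega)
    rw [iterPos_zero, mul_zero, zero_add] at h
    rw [h]
    exact factorAt_mem_language _ _ _
  rcases orient_eq q with hq | hq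
  · exact main q hq w hw
  · obtain ⟨i, hi⟩ := hw
    have hk := bispLen_strictMono.le_apply (x := i + w.length)
    obtain ⟨p, hp, hps⟩ := exists_orient_shift 1 (parity 0 + parity (0 + bispLen (i + w.length)))
    have hpal := isPal_iterPos (i + w.length) 0
    rw [iterPos_zero] at hpal
    have h := act_factorAt_of_isPal hpal hp hps (i := i) (n := w.length)
      (i' := 2 * bispLen (i + w.length) + 3 - i - w.length) (by omega) (by omega) (by omega)
    have hpw : act p w ∈ language wordV := by
      rw [hi, h]
      exact factorAt_mem_language _ _ _
    have := main (q + p) (by rw [orient_add, hq, hp]; decide) _ hpw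
    rwa [act_add, act_act] at this

/-! ### A criterion for the tree property -/

theorem isTree_of_forall_eq_or_eq {V : Type*} {Γ : SimpleGraph V} {a b : V} (hab : Γ.Adj a b)
    (h : ∀ x, x = a ∨ x = b) : Γ.IsTree := by
  have hr : ∀ x, Γ.Reachable x a := by
    intro x
    rcases h x with rfl | rfl
    · exact .rfl
    · exact hab.symm.reachable
  have : Nonempty V := ⟨a⟩
  refine ⟨⟨fun x y => (hr x).trans (hr y).symm⟩, .of_card_le_two ?_⟩
  have hs : Function.Surjective fun c : Bool => cond c a b := by
    intro x
    rcases h x with rfl | rfl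
    · exact ⟨true, rfl⟩
    · exact ⟨false, rfl⟩
  exact (ENat.card_le_card_of_injective (Function.injective_surjInv hs)).trans (by simp)

section Criterion

variable {G : Subgroup (Equiv.Perm (List (Fin 6)))} {lam : SymIndex →+ ZMod 2}

theorem mem_cls_iff (hG : ∀ ν, ν ∈ G ↔ ∃ q, lam q = 0 ∧ ∀ w, ν w = act q w)
    {x w : List (Fin 6)} : x ∈ cls G w ↔ ∃ q, lam q = 0 ∧ x = act q w := by
  constructor
  · rintro ⟨ν, hν, rfl⟩
    obtain ⟨q, hq, h⟩ := (hG ν).1 hν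
    exact ⟨q, hq, h w⟩
  · rintro ⟨q, hq, rfl⟩
    let ν : Equiv.Perm (List (Fin 6)) := (show Function.Involutive (act q) from act_act q).toPerm
    exact ⟨ν, (hG ν).2 ⟨q, hq, fun _ => rfl⟩, rfl⟩

theorem cls_eq_of_mem {G : Subgroup (Equiv.Perm (List (Fin 6)))} {x w : List (Fin 6)}
    (h : x ∈ cls G w) : cls G x = cls G w := by
  obtain ⟨ν, hν, rfl⟩ := h
  ext y
  constructor
  · rintro ⟨κ, hκ, rfl⟩
    exact ⟨κ * ν, G.mul_mem hκ hν, rfl⟩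
  · rintro ⟨κ, hκ, rfl⟩
    exact ⟨κ * ν⁻¹, G.mul_mem hκ (G.inv_mem hν), by simp⟩

theorem self_mem_cls (G : Subgroup (Equiv.Perm (List (Fin 6)))) (w : List (Fin 6)) :
    w ∈ cls G w := ⟨1, G.one_mem, rfl⟩

theorem eq_cls_of_mem_symVertices {u : ℕ → Fin 6} {n : ℕ} {P : Set (List (Fin 6))}
    {w : List (Fin 6)} (hP : P ∈ symVertices G u n) (hw : w ∈ P) : P = cls G w := by
  obtain ⟨x, -, -, rfl⟩ := hP
  exact (cls_eq_of_mem hw).symm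

theorem closedUnder_of_forall_act (hG : ∀ ν, ν ∈ G ↔ ∃ q, lam q = 0 ∧ ∀ w, ν w = act q w) :
    ClosedUnder G wordV := by
  intro w hw ν hν
  obtain ⟨q, -, h⟩ := (hG ν).1 hν
  rw [h]
  exact act_mem_language q hw

theorem drop_eq_act_take {q : SymIndex} (hq : orient q = 1) {e : List (Fin 6)} (he : act q e = e)
    (n : ℕ) : e.drop (e.length - n) = act q (e.take n) := by
  conv_lhs => rw [← he]
  rw [act_of_orient_one hq, act_of_orient_one hq, List.map_take, List.reverse_take]
  simp

theorem exists_gen_ne_zero {q : SymIndex} (h : lam q ≠ 0) : ∃ i, lam (gen i) ≠ 0 := by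
  by_contra! hc
  apply h
  rw [eq_sum_gen q, map_add, map_add]
  split_ifs <;> simp [hc]

theorem add_eq_zero_of_ne_zero {a b : ZMod 2} (ha : a ≠ 0) (hb : b ≠ 0) : a + b = 0 := by
  revert a b; decide

/-- A criterion for the two conditions on the graph of order `n`. The hypothesis `hlam` says that
the group contains all of `Ψ₀, Ψ₁, Ψ₂` except at most one. Every edge is fixed by some `Ψ_i`, its
type. An edge whose type is in the group is a loop. The edges of the exceptional type join two
different classes by `hstab`, they form one class, and they reach all vertices. When there are no
such edges, the exceptional `Ψ_i`, if there is one, fixes a special factor, and there is only one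
vertex. -/
theorem loops_and_tree_of_types (hG : ∀ ν, ν ∈ G ↔ ∃ q, lam q = 0 ∧ ∀ w, ν w = act q w)
    (hlam : ∀ i j, lam (gen i) ≠ 0 → lam (gen j) ≠ 0 → i = j) {n : ℕ}
    (T : Fin 3 → List (Fin 6) → Prop)
    (hne : ∃ w : List (Fin 6), w.length = n ∧ IsSpecial wordV w)
    (horb : ∀ w w' : List (Fin 6), w.length = n → w'.length = n → IsSpecial wordV w →
      IsSpecial wordV w' → ∃ q, w' = act q w)
    (hT : ∀ e, IsDirectedEdge wordV n e → ∃ i, T i e)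
    (hpal : ∀ i e, T i e → act (gen i) e = e)
    (horbT : ∀ i e e', T i e → T i e' → ∃ q, e' = act q e)
    (hstab : ∀ i e, IsDirectedEdge wordV n e → T i e → lam (gen i) ≠ 0 →
      ∀ q, act q (e.take n) = e.take n → lam q = 0)
    (hex : ∀ i, (∃ e, IsDirectedEdge wordV n e ∧ T i e) ∨
      ∃ w : List (Fin 6), w.length = n ∧ IsSpecial wordV w ∧ act (gen i) w = w) :
    (∀ e P, DirectedJoins G wordV n e P P → IsGPalindrome G e) ∧
      IsTreeWithoutLoops G wordV n := by
  have hsuf : ∀ i e, T i e → e.drop (e.length - n) = act (gen i) (e.take n) :=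
    fun i e h => drop_eq_act_take (orient_gen i) (hpal i e h) n
  have hlen : ∀ e : List (Fin 6), IsDirectedEdge wordV n e → (e.take n).length = n := by
    intro e he
    rw [List.length_take]
    have := he.2.1
    omega
  have hloop : ∀ i e, T i e → lam (gen i) = 0 →
      cls G (e.drop (e.length - n)) = cls G (e.take n) := fun i e h hi =>
    cls_eq_of_mem ((mem_cls_iff hG).2 ⟨_, hi, hsuf i e h⟩)
  have hnonloop : ∀ i e, IsDirectedEdge wordV n e → T i e → lam (gen i) ≠ 0 →
      cls G (e.drop (e.length - n)) ≠ cls G (e.take n) := by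
    intro i e he h hi hc
    obtain ⟨q, hq, hqe⟩ := (mem_cls_iff hG).1 (hc ▸ self_mem_cls G (e.drop (e.length - n)))
    have h1 : act (q + gen i) (e.take n) = e.take n := by
      rw [add_comm, act_add, ← hqe, hsuf i e h, act_act]
    have h2 := hstab i e he h hi _ h1
    rw [map_add, hq, zero_add] at h2
    exact hi h2
  have hjoin : ∀ e P Q, DirectedJoins G wordV n e P Q →
      P = cls G (e.take n) ∧ Q = cls G (e.drop (e.length - n)) := fun e P Q h =>
    ⟨eq_cls_of_mem_symVertices h.2.1 h.2.2.2.1, eq_cls_of_mem_symVertices h.2.2.1 h.2.2.2.2⟩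
  have hjoins : ∀ E P Q, P ≠ Q → Joins G wordV n E P Q →
      ∃ i e, E = cls G e ∧ T i e ∧ lam (gen i) ≠ 0 := by
    rintro E P Q hPQ ⟨e, rfl, he⟩
    have hedge : IsDirectedEdge wordV n e := by rcases he with he | he <;> exact he.1
    obtain ⟨i, hi⟩ := hT e hedge
    refine ⟨i, e, rfl, hi, fun h0 => hPQ ?_⟩
    have := hloop i e hi h0
    rcases he with he | he
    · rw [(hjoin e P Q he).1, (hjoin e P Q he).2, this]
    · rw [(hjoin e Q P he).1, (hjoin e Q P he).2, this]
  refine ⟨fun e P he => ?_, fun P Q hPQ E E' hE hE' => ?_, ?_⟩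
  · obtain ⟨i, hi⟩ := hT e he.1
    have h0 : lam (gen i) = 0 := by
      by_contra h0
      exact hnonloop i e he.1 hi h0 ((hjoin e P P he).2.symm.trans (hjoin e P P he).1)
    refine ⟨Psi i, (hG _).2 ⟨gen i, h0, fun w => (act_gen i w).symm⟩, ?_, ?_⟩
    · intro v w
      simpa only [act_gen] using isAntimorphism_act (orient_gen i) v w
    · rw [← act_gen, hpal i e hi]
  · obtain ⟨i, e, rfl, hi, hi0⟩ := hjoins E P Q hPQ hE
    obtain ⟨i', e', rfl, hi', hi0'⟩ := hjoins E' P Q hPQ hE'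
    obtain rfl := hlam i i' hi0 hi0'
    obtain ⟨q, rfl⟩ := horbT i e e' hi hi'
    refine (cls_eq_of_mem ((mem_cls_iff hG).2 ?_)).symm
    by_cases hq : lam q = 0
    · exact ⟨q, hq, rfl⟩
    · exact ⟨q + gen i, by rw [map_add, add_eq_zero_of_ne_zero hq hi0], by
        rw [act_add, hpal i e hi]⟩
  · by_cases hcase : ∃ i e, IsDirectedEdge wordV n e ∧ T i e ∧ lam (gen i) ≠ 0
    · obtain ⟨i, e, he, hi, hi0⟩ := hcase
      have hA : cls G (e.take n) ∈ symVertices G wordV n := ⟨_, hlen e he, he.2.2.1, rfl⟩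
      have hB : cls G (e.drop (e.length - n)) ∈ symVertices G wordV n :=
        ⟨_, by rw [hsuf i e hi, length_act, hlen e he], he.2.2.2.1, rfl⟩
      refine isTree_of_forall_eq_or_eq (a := ⟨_, hA⟩) (b := ⟨_, hB⟩)
        ⟨fun h => hnonloop i e he hi hi0 (congrArg Subtype.val h).symm, cls G e, e, rfl,
          Or.inl ⟨he, hA, hB, self_mem_cls _ _, self_mem_cls _ _⟩⟩ ?_
      rintro ⟨_, w, hw, hsp, rfl⟩
      obtain ⟨q, rfl⟩ := horb _ w (hlen e he) hw he.2.2.1 hsp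
      by_cases hq : lam q = 0
      · exact Or.inl (Subtype.ext (cls_eq_of_mem ((mem_cls_iff hG).2 ⟨q, hq, rfl⟩)))
      · refine Or.inr (Subtype.ext (cls_eq_of_mem ((mem_cls_iff hG).2 ⟨q + gen i, ?_, ?_⟩)))
        · rw [map_add, add_eq_zero_of_ne_zero hq hi0]
        · rw [hsuf i e hi, act_add, act_act]
    · have hall : ∀ w w' : List (Fin 6), w.length = n → w'.length = n → IsSpecial wordV w →
          IsSpecial wordV w' → cls G w' = cls G w := by
        intro w w' hw hw' hs hs'
        refine cls_eq_of_mem ((mem_cls_iff hG).2 ?_)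
        obtain ⟨q, rfl⟩ := horb w w' hw hw' hs hs'
        by_cases hq : lam q = 0
        · exact ⟨q, hq, rfl⟩
        · obtain ⟨i, hi0⟩ := exists_gen_ne_zero hq
          rcases hex i with ⟨e, he, hi⟩ | ⟨x, hx, hxs, hix⟩
          · exact absurd ⟨i, e, he, hi, hi0⟩ hcase
          · obtain ⟨p, rfl⟩ := horb x w hx hw hxs hs
            exact ⟨q + gen i, by rw [map_add, add_eq_zero_of_ne_zero hq hi0], by
              rw [act_add, act_comm (gen i) p, hix]⟩
      obtain ⟨w, hw, hs⟩ := hne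
      have : Subsingleton (symVertices G wordV n) := by
        refine ⟨?_⟩
        rintro ⟨_, x, hx, hxs, rfl⟩ ⟨_, y, hy, hys, rfl⟩
        exact Subtype.ext (hall _ _ hy hx hys hxs)
      have : Nonempty (symVertices G wordV n) := ⟨⟨_, w, hw, hs, rfl⟩⟩
      exact SimpleGraph.IsTree.of_subsingleton

end Criterion

/-! ### Edges as factors between consecutive special positions -/

section Positions

variable {A : Type*} {u : ℕ → A} {n g : ℕ} {p : ℕ → ℕ}

theorem isDirectedEdge_factorAt {i L : ℕ} :
    IsDirectedEdge u n (factorAt u i L) ↔ n + 1 ≤ L ∧ IsSpecial u (factorAt u i n) ∧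
      IsSpecial u (factorAt u (i + (L - n)) n) ∧
      ∀ d, 0 < d → d + n < L → ¬ IsSpecial u (factorAt u (i + d) n) := by
  unfold IsDirectedEdge
  rw [length_factorAt]
  have hmid : ∀ d, d + n ≤ L → ((factorAt u i L).drop d).take n = factorAt u (i + d) n := by
    intro d hd
    rw [show L = d + (L - d) by omega, drop_factorAt, take_factorAt _ _ (by omega)]
  constructor
  · rintro ⟨-, h1, h2, h3, h4⟩
    refine ⟨h1, ?_, ?_, fun d hd hdL => ?_⟩
    · rwa [take_factorAt _ _ (by omega)] at h2
    · rwa [show L = L - n + n by omega, show L - n + n - n = L - n by omega, drop_factorAt] at h3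
    · rw [← hmid d (by omega)]
      exact h4 d hd hdL
  · rintro ⟨h1, h2, h3, h4⟩
    refine ⟨factorAt_mem_language _ _ _, h1, ?_, ?_, fun d hd hdL => ?_⟩
    · rwa [take_factorAt _ _ (by omega)]
    · rw [show L = L - n + n by omega, show L - n + n - n = L - n by omega, drop_factorAt]
      exact h3
    · rw [hmid d (by omega)]
      exact h4 d hd hdL

theorem eq_of_le_of_lt_succ (hp : StrictMono p) {j j' y : ℕ} (h1 : p j ≤ y) (h2 : y < p (j + 1))
    (h1' : p j' ≤ y) (h2' : y < p (j' + 1)) : j = j' := by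
  have := hp.lt_iff_lt.1 (h1.trans_lt h2')
  have := hp.lt_iff_lt.1 (h1'.trans_lt h2)
  omega

theorem mem_positions_between (hp : StrictMono p) (hg : ∀ j, p j + g < p (j + 1)) {j y : ℕ}
    (hy : ∃ j, y = p j ∨ y = p j + g) (h1 : p j ≤ y) (h2 : y < p (j + 1)) :
    y = p j ∨ y = p j + g := by
  obtain ⟨j', hy⟩ := hy
  have h3 := hg j'
  obtain rfl := eq_of_le_of_lt_succ hp (j := j) (j' := j') h1 h2 (by omega) (by omega)
  exact hy

theorem isDirectedEdge_inner (hp : StrictMono p) (hg : ∀ j, p j + g < p (j + 1))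
    (hS : ∀ i, IsSpecial u (factorAt u i n) ↔ ∃ j, i = p j ∨ i = p j + g) (h0 : 0 < g) (j : ℕ) :
    IsDirectedEdge u n (factorAt u (p j) (g + n)) := by
  refine isDirectedEdge_factorAt.2 ⟨by omega, (hS _).2 ⟨j, Or.inl rfl⟩,
    (hS _).2 ⟨j, Or.inr (by omega)⟩, fun d hd hd' h => ?_⟩
  have h1 := hg j
  rcases mem_positions_between hp hg ((hS _).1 h) (show p j ≤ p j + d by omega) (by omega)
    with h | h <;> omega

theorem isDirectedEdge_outer (hp : StrictMono p) (hg : ∀ j, p j + g < p (j + 1))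
    (hS : ∀ i, IsSpecial u (factorAt u i n) ↔ ∃ j, i = p j ∨ i = p j + g) {j L : ℕ}
    (hL : p j + g + L = p (j + 1) + n) : IsDirectedEdge u n (factorAt u (p j + g) L) := by
  have h1 := hg j
  refine isDirectedEdge_factorAt.2 ⟨by omega, (hS _).2 ⟨j, Or.inr rfl⟩,
    (hS _).2 ⟨j + 1, Or.inl (by omega)⟩, fun d hd hd' h => ?_⟩
  rcases mem_positions_between hp hg ((hS _).1 h) (show p j ≤ p j + g + d by omega) (by omega)
    with h | h <;> omega

theorem IsDirectedEdge.eq_factorAt (hp : StrictMono p) (hg : ∀ j, p j + g < p (j + 1))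
    (hS : ∀ i, IsSpecial u (factorAt u i n) ↔ ∃ j, i = p j ∨ i = p j + g) {e : List A}
    (he : IsDirectedEdge u n e) :
    (0 < g ∧ ∃ j, e = factorAt u (p j) (g + n)) ∨
      ∃ j L, p j + g + L = p (j + 1) + n ∧ e = factorAt u (p j + g) L := by
  obtain ⟨i, hi⟩ := he.1
  rw [hi] at he
  generalize hL : e.length = L at *
  obtain ⟨h1, h2, h3, h4⟩ := isDirectedEdge_factorAt.1 he
  have outer : ∀ j, i = p j + g → ∃ j L, p j + g + L = p (j + 1) + n ∧
      e = factorAt u (p j + g) L := by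
    intro j hj
    have hj1 := hg j
    refine ⟨j, L, ?_, hj ▸ hi⟩
    rcases lt_trichotomy (i + (L - n)) (p (j + 1)) with h | h | h
    · rcases mem_positions_between hp hg ((hS _).1 h3) (show p j ≤ _ by omega) h
        with h | h <;> omega
    · omega
    · refine absurd ((hS _).2 ⟨j + 1, Or.inl ?_⟩) (h4 (p (j + 1) - i) (by omega) (by omega))
      omega
  obtain ⟨j, hj | hj⟩ := (hS _).1 h2
  · rcases Nat.eq_zero_or_pos g with h0 | h0
    · exact Or.inr (outer j (by omega))
    · refine Or.inl ⟨h0, j, ?_⟩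
      have hj1 := hg j
      have : L = g + n := by
        rcases lt_or_ge (p j + g) (i + (L - n)) with h | h
        · refine absurd ((hS _).2 ⟨j, Or.inr ?_⟩) (h4 g (by omega) (by omega))
          omega
        · rcases mem_positions_between hp hg ((hS _).1 h3) (show p j ≤ _ by omega) (by omega)
            with h | h <;> omega
      rw [hi, hj, this]
  · exact Or.inr (outer j hj)

end Positions

/-! ### Special factors of `v` -/

theorem wordV_eq_mod_two {y y' : ℕ} (h : wordV y = wordV y') : y % 2 = y' % 2 := by
  rcases Nat.even_or_odd' y with ⟨c, rfl | rfl⟩ <;> rcases Nat.even_or_odd' y' with ⟨c', rfl | rfl⟩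
  · omega
  · rw [wordV_even, wordV_odd] at h
    exact absurd h (evenLetter_ne_oddLetter _ _)
  · rw [wordV_even, wordV_odd] at h
    exact absurd h.symm (evenLetter_ne_oddLetter _ _)
  · omega

theorem parity_eq_of_wordV_odd_eq {c c' : ℕ} (h : wordV (2 * c + 1) = wordV (2 * c' + 1)) :
    parity c = parity c' := by
  rw [wordV_odd, wordV_odd] at h
  exact oddLetter_injective h

/-- A letter at an odd position of `v` determines its two neighbours. -/
theorem wordV_neighbours_of_odd {c c' : ℕ} (h : wordV (2 * c + 1) = wordV (2 * c' + 1)) :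
    wordV (2 * c) = wordV (2 * c') ∧ wordV (2 * c + 2) = wordV (2 * c' + 2) := by
  have h1 : (c : ZMod 2) = c' := by
    rw [← parity_fst_add_snd, ← parity_fst_add_snd, parity_eq_of_wordV_odd_eq h]
  constructor
  · rw [wordV_even, wordV_even, h1]
  · rw [← Nat.mul_succ, ← Nat.mul_succ, wordV_even, wordV_even]
    push_cast
    rw [h1]

theorem letterParity_injective : Function.Injective letterParity := by
  unfold Function.Injective
  decide

/-- A factor of the Fibonacci word can be read off from the differences of parity vectors. -/
theorem sameFactor_of_parity {c c' m : ℕ} {t : ZMod 2 × ZMod 2}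
    (h : ∀ r ≤ m, parity (c + r) = parity (c' + r) + t) : SameFactor c c' m := by
  intro r hr
  have h1 := h (r + 1) hr
  rw [← add_assoc, ← add_assoc, parity_succ, parity_succ, h r hr.le, add_right_comm] at h1
  exact letterParity_injective (add_left_cancel (add_right_cancel h1))

theorem fib_ne_of_parity_ne {c c' : ℕ}
    (h : ¬(parity c = parity c' ↔ parity (c + 1) = parity (c' + 1))) : fib c ≠ fib c' := by
  intro hf
  apply h
  rw [parity_succ, parity_succ, hf, add_left_inj]

theorem cons_mem_language {u : ℕ → Fin 6} {b : Fin 6} {i n : ℕ}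
    (h : b :: factorAt u i n ∈ language u) :
    ∃ y, u y = b ∧ ∀ r < n, u (y + 1 + r) = u (i + r) := by
  obtain ⟨y, hy⟩ := h
  rw [List.length_cons, length_factorAt, factorAt_succ', List.cons.injEq, factorAt_eq_iff] at hy
  exact ⟨y, hy.1.symm, fun r hr => (hy.2 r hr).symm⟩

theorem append_mem_language {u : ℕ → Fin 6} {b : Fin 6} {i n : ℕ}
    (h : factorAt u i n ++ [b] ∈ language u) :
    ∃ y, u (y + n) = b ∧ ∀ r < n, u (y + r) = u (i + r) := by
  obtain ⟨y, hy⟩ := h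
  rw [List.length_append, length_factorAt, List.length_singleton, factorAt_succ] at hy
  have h2 := List.append_inj hy (by simp)
  rw [factorAt_eq_iff, List.singleton_inj] at h2
  exact ⟨y, h2.2.symm, fun r hr => (h2.1 r hr).symm⟩

theorem IsSpecial.act {w : List (Fin 6)} (h : IsSpecial wordV w) (q : SymIndex) :
    IsSpecial wordV (act q w) := by
  have inj : ∀ a b, a ≠ b → letterAct q a ≠ letterAct q b := by
    intro a b hab hc
    apply hab
    have := congrArg (letterAct q) hc
    rw [← letterAct_add, ← letterAct_add, add_self_index] at this
    simpa [letterAct] using this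
  have hcons : ∀ a, a :: w ∈ language wordV →
      (orient q = 0 ∧ letterAct q a :: SymWords.act q w ∈ language wordV) ∨
      (orient q = 1 ∧ SymWords.act q w ++ [letterAct q a] ∈ language wordV) := by
    intro a ha
    have h := act_mem_language q ha
    rcases orient_eq q with hq | hq
    · rw [act_of_orient_zero hq, List.map_cons, ← act_of_orient_zero hq] at h
      exact Or.inl ⟨hq, h⟩
    · rw [act_of_orient_one hq, List.map_cons, List.reverse_cons, ← act_of_orient_one hq] at h
      exact Or.inr ⟨hq, h⟩
  have happ : ∀ a, w ++ [a] ∈ language wordV →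
      (orient q = 1 ∧ letterAct q a :: SymWords.act q w ∈ language wordV) ∨
      (orient q = 0 ∧ SymWords.act q w ++ [letterAct q a] ∈ language wordV) := by
    intro a ha
    have h := act_mem_language q ha
    rcases orient_eq q with hq | hq
    · rw [act_of_orient_zero hq, List.map_append, ← act_of_orient_zero hq] at h
      exact Or.inr ⟨hq, h⟩
    · rw [act_of_orient_one hq, List.map_append, List.reverse_append] at h
      exact Or.inl ⟨hq, by rw [act_of_orient_one hq]; exact h⟩
  have h01 : (0 : ZMod 2) ≠ 1 := by decide
  refine ⟨act_mem_language q h.1, ?_⟩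
  rcases h.2 with ⟨a, ha, b, hb, hab⟩ | ⟨a, ha, b, hb, hab⟩
  · rcases hcons a ha with ⟨hq, ha'⟩ | ⟨hq, ha'⟩ <;> rcases hcons b hb with ⟨hq', hb'⟩ | ⟨hq', hb'⟩
    · exact Or.inl ⟨_, ha', _, hb', inj a b hab⟩
    · exact absurd (hq.symm.trans hq') h01
    · exact absurd (hq'.symm.trans hq) h01
    · exact Or.inr ⟨_, ha', _, hb', inj a b hab⟩
  · rcases happ a ha with ⟨hq, ha'⟩ | ⟨hq, ha'⟩ <;> rcases happ b hb with ⟨hq', hb'⟩ | ⟨hq', hb'⟩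
    · exact Or.inl ⟨_, ha', _, hb', inj a b hab⟩
    · exact absurd (hq'.symm.trans hq) h01
    · exact absurd (hq.symm.trans hq') h01
    · exact Or.inr ⟨_, ha', _, hb', inj a b hab⟩

/-- `n` is the length of a factor of `v` covering a factor of length `m` of the Fibonacci word, and
`k` is the number of the shortest bispecial factor of length at least `m`. -/
structure IsLevel (k m n : ℕ) : Prop where
  lt : ∀ k' < k, bispLen k' < m
  le : m ≤ bispLen k
  length : n = 2 * m + 2 ∨ n = 2 * m + 3

theorem exists_isLevel {n : ℕ} (hn : 2 ≤ n) : ∃ k m, IsLevel k m n := by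
  have hex : ∃ k, (n - 2) / 2 ≤ bispLen k := ⟨_, bispLen_strictMono.le_apply⟩
  classical
  exact ⟨Nat.find hex, (n - 2) / 2, fun k' hk' => not_le.1 (Nat.find_min hex hk'),
    Nat.find_spec hex, by omega⟩

section Level

variable {k m n : ℕ}

/-- The position of the suffix of length `n` inside the factor of length `2 * bispLen k + 3` of `v`
that lies over the bispecial factor number `k`. -/
def offset (k n : ℕ) : ℕ := 2 * bispLen k + 3 - n

theorem IsLevel.offset_add (h : IsLevel k m n) : offset k n + n = 2 * bispLen k + 3 := by
  have := h.le
  have := h.length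
  unfold offset
  omega

theorem IsLevel.two_mul_iterPos_add_offset_lt (h : IsLevel k m n) (j : ℕ) :
    2 * iterPos k j + offset k n < 2 * iterPos k (j + 1) := by
  have := bispLen_add_iterPos_lt h.lt j
  have := h.offset_add
  have := h.length
  omega

theorem two_mul_iterPos_strictMono (k : ℕ) : StrictMono fun j => 2 * iterPos k j :=
  (iterPos_strictMono k).const_mul two_pos

theorem IsLevel.exists_act_prefix (h : IsLevel k m n) (j j' : ℕ) : ∃ q,
    act q (factorAt wordV (2 * iterPos k j) n) = factorAt wordV (2 * iterPos k j') n := by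
  obtain ⟨q, hq, hs⟩ := exists_orient_shift 0 (parity (iterPos k j) + parity (iterPos k j'))
  have := h.offset_add
  exact ⟨q, act_factorAt_of_sameFactor (sameFactor_iterPos k j j') hq hs (r := 0) (by omega)⟩

theorem IsLevel.act_prefix (h : IsLevel k m n) {i j : ℕ} {q : SymIndex} (hq : orient q = 1)
    (hs : shift q = parity (iterPos k j) + parity (iterPos k j + bispLen k))
    (hi : i = 2 * iterPos k j + offset k n) :
    act q (factorAt wordV (2 * iterPos k j) n) = factorAt wordV i n := by
  have := h.offset_add
  exact act_factorAt_of_isPal (isPal_iterPos k j) hq hs le_rfl (by omega) (by omega)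

theorem IsLevel.isSpecial_prefix (h : IsLevel k m n) (j : ℕ) :
    IsSpecial wordV (factorAt wordV (2 * iterPos k j) n) := by
  -- Two consecutive returns coded by different letters are followed by the same bispecial factor.
  suffices h1 : IsSpecial wordV (factorAt wordV (2 * iterPos k 1) n) by
    obtain ⟨q, hq⟩ := h.exists_act_prefix 1 j
    exact hq ▸ h1.act q
  obtain ⟨q, hq, hs⟩ := exists_orient_shift 0 (parity (iterPos k 2) + parity (iterPos k 1))
  have hN := h.offset_add
  have htr : act q (factorAt wordV (2 * iterPos k 2) n) = factorAt wordV (2 * iterPos k 1) n :=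
    act_factorAt_of_sameFactor (sameFactor_iterPos k 2 1) hq hs (r := 0) (by omega)
  have hpos : ∀ j, ∃ y, y + 1 = iterPos k (j + 1) := by
    intro j
    have := iterPos_strictMono k (Nat.succ_pos j)
    rw [iterPos_zero, Nat.succ_eq_add_one] at this
    exact ⟨iterPos k (j + 1) - 1, by omega⟩
  obtain ⟨y, hy⟩ := hpos 0
  obtain ⟨y', hy'⟩ := hpos 1
  have hne : fib y ≠ fib y' := by
    rw [Ne, fib_before_eq_iff hy hy', fib_zero, fib_one]
    decide
  have hcons : ∀ y, wordV (2 * y + 1) :: factorAt wordV (2 * (y + 1)) n ∈ language wordV := by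
    intro y
    rw [show 2 * (y + 1) = 2 * y + 1 + 1 by ring, ← factorAt_succ']
    exact factorAt_mem_language _ _ _
  refine ⟨factorAt_mem_language _ _ _, Or.inl ⟨wordV (2 * y + 1), ?_,
    letterAct q (wordV (2 * y' + 1)), ?_, ?_⟩⟩
  · have := hcons y
    rwa [hy] at this
  · have := act_mem_language q (hcons y')
    rwa [hy', act_of_orient_zero hq, List.map_cons, ← act_of_orient_zero hq, htr] at this
  · rw [wordV_odd, wordV_odd, letterAct_oddLetter, hs]
    intro hc
    have hc := oddLetter_injective hc
    rw [← hy, ← hy', parity_succ, parity_succ] at hc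
    have cancel : ∀ a b c d : ZMod 2 × ZMod 2, a = b + (b + d + (a + c)) → c = d := by
      intro a b c d h
      have double : ∀ b : ZMod 2 × ZMod 2, b + b = 0 := by decide
      have h2 : a + a = (b + b) + (a + a) + (c + d) := by
        nth_rewrite 1 [h]; abel
      rw [double, double, zero_add, zero_add] at h2
      calc c = c + (d + d) := by rw [double, add_zero]
        _ = d := by rw [← add_assoc, ← h2, zero_add]
    exact hne (letterParity_injective (cancel _ _ _ _ hc))

theorem IsLevel.isSpecial_suffix (h : IsLevel k m n) (j : ℕ) :
    IsSpecial wordV (factorAt wordV (2 * iterPos k j + offset k n) n) := by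
  obtain ⟨q, hq, hs⟩ := exists_orient_shift 1
    (parity (iterPos k j) + parity (iterPos k j + bispLen k))
  rw [← h.act_prefix hq hs rfl]
  exact (h.isSpecial_prefix j).act q

theorem IsLevel.exists_of_leftExt (h : IsLevel k m n) {i : ℕ}
    (hi : (leftExt wordV (factorAt wordV i n)).Nontrivial) : ∃ j, i = 2 * iterPos k j := by
  obtain ⟨b, hb, b', hb', hne⟩ := hi
  obtain ⟨y, rfl, hy⟩ := cons_mem_language hb
  obtain ⟨y', rfl, hy'⟩ := cons_mem_language hb'
  have hn := h.length
  have h0 := wordV_eq_mod_two (hy 0 (by omega))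
  have h0' := wordV_eq_mod_two (hy' 0 (by omega))
  rcases Nat.even_or_odd' i with ⟨c, rfl | rfl⟩
  · obtain ⟨a, rfl⟩ : ∃ a, y = 2 * a + 1 := ⟨y / 2, by omega⟩
    obtain ⟨a', rfl⟩ : ∃ a', y' = 2 * a' + 1 := ⟨y' / 2, by omega⟩
    have hp : ∀ r ≤ m, parity (a + 1 + r) = parity (c + r) := fun r hr =>
      parity_eq_of_wordV_odd_eq (by
        have := hy (2 * r + 1) (by omega)
        rwa [show 2 * a + 1 + 1 + (2 * r + 1) = 2 * (a + 1 + r) + 1 by ring,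
          show 2 * c + (2 * r + 1) = 2 * (c + r) + 1 by ring] at this)
    have hp' : ∀ r ≤ m, parity (a' + 1 + r) = parity (c + r) := fun r hr =>
      parity_eq_of_wordV_odd_eq (by
        have := hy' (2 * r + 1) (by omega)
        rwa [show 2 * a' + 1 + 1 + (2 * r + 1) = 2 * (a' + 1 + r) + 1 by ring,
          show 2 * c + (2 * r + 1) = 2 * (c + r) + 1 by ring] at this)
    have hs : SameFactor (a + 1) c m := sameFactor_of_parity (t := 0) (by simpa using hp)
    have hs' : SameFactor (a' + 1) c m := sameFactor_of_parity (t := 0) (by simpa using hp')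
    have hf : fib a ≠ fib a' := by
      refine fib_ne_of_parity_ne fun hiff => hne ?_
      rw [wordV_odd, wordV_odd, hiff.2 ((hp 0 (by omega)).trans (hp' 0 (by omega)).symm)]
    obtain ⟨j, hj⟩ := eq_iterPos_of_fib_ne_before h.lt (hs.trans hs'.symm) hf
    have h1 := (sameFactor_iterPos k j 0).mono h.le
    rw [← hj, iterPos_zero] at h1
    obtain ⟨j', rfl⟩ := eq_iterPos_of_sameFactor h.lt (hs.symm.trans h1)
    exact ⟨j', rfl⟩
  · obtain ⟨a, rfl⟩ : ∃ a, y = 2 * a := ⟨y / 2, by omega⟩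
    obtain ⟨a', rfl⟩ : ∃ a', y' = 2 * a' := ⟨y' / 2, by omega⟩
    exact absurd (wordV_neighbours_of_odd
      ((hy 0 (by omega)).trans (hy' 0 (by omega)).symm)).1 hne

theorem IsLevel.exists_of_rightExt (h : IsLevel k m n) {i : ℕ}
    (hi : (rightExt wordV (factorAt wordV i n)).Nontrivial) :
    ∃ j, i = 2 * iterPos k j + offset k n := by
  obtain ⟨b, hb, b', hb', hne⟩ := hi
  obtain ⟨y, rfl, hy⟩ := append_mem_language hb
  obtain ⟨y', rfl, hy'⟩ := append_mem_language hb'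
  have hn := h.length
  have hN := h.offset_add
  have h0 := wordV_eq_mod_two (hy 0 (by omega))
  have h0' := wordV_eq_mod_two (hy' 0 (by omega))
  rcases Nat.even_or_odd' (i + n) with ⟨c, hc | hc⟩
  · obtain ⟨a, ha⟩ : ∃ a, y + n = 2 * a + 2 := ⟨(y + n) / 2 - 1, by omega⟩
    obtain ⟨a', ha'⟩ : ∃ a', y' + n = 2 * a' + 2 := ⟨(y' + n) / 2 - 1, by omega⟩
    have h1 := (hy (n - 1) (by omega)).trans (hy' (n - 1) (by omega)).symm
    rw [show y + (n - 1) = 2 * a + 1 by omega, show y' + (n - 1) = 2 * a' + 1 by omega] at h1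
    rw [ha, ha'] at hne
    exact absurd (wordV_neighbours_of_odd h1).2 hne
  · -- The odd positions of the factor carry the parity vectors of `m + 1` consecutive positions.
    obtain ⟨s, hs⟩ : ∃ s, n + s = 2 * m + 3 := ⟨2 * m + 3 - n, by omega⟩
    obtain ⟨a₀, rfl⟩ : ∃ a, i = 2 * a + s := ⟨(i - s) / 2, by omega⟩
    obtain ⟨a, rfl⟩ : ∃ a, y = 2 * a + s := ⟨(y - s) / 2, by omega⟩
    obtain ⟨a', rfl⟩ : ∃ a, y' = 2 * a + s := ⟨(y' - s) / 2, by omega⟩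
    have hp : ∀ r ≤ m, parity (a + r) = parity (a₀ + r) := fun r hr =>
      parity_eq_of_wordV_odd_eq (by
        have := hy (2 * r + 1 - s) (by omega)
        rwa [show 2 * a + s + (2 * r + 1 - s) = 2 * (a + r) + 1 by omega,
          show 2 * a₀ + s + (2 * r + 1 - s) = 2 * (a₀ + r) + 1 by omega] at this)
    have hp' : ∀ r ≤ m, parity (a' + r) = parity (a₀ + r) := fun r hr =>
      parity_eq_of_wordV_odd_eq (by
        have := hy' (2 * r + 1 - s) (by omega)
        rwa [show 2 * a' + s + (2 * r + 1 - s) = 2 * (a' + r) + 1 by omega,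
          show 2 * a₀ + s + (2 * r + 1 - s) = 2 * (a₀ + r) + 1 by omega] at this)
    have hs : SameFactor a a₀ m := sameFactor_of_parity (t := 0) (by simpa using hp)
    have hs' : SameFactor a' a₀ m := sameFactor_of_parity (t := 0) (by simpa using hp')
    have hf : fib (a + m) ≠ fib (a' + m) := by
      refine fib_ne_of_parity_ne fun hiff => hne ?_
      rw [show 2 * a + s + n = 2 * (a + m + 1) + 1 by omega,
        show 2 * a' + s + n = 2 * (a' + m + 1) + 1 by omega, wordV_odd, wordV_odd,
        hiff.1 ((hp m le_rfl).trans (hp' m le_rfl).symm)]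
    obtain ⟨j, hj⟩ := add_eq_iterPos_add_of_fib_ne_after h.lt (hs.trans hs'.symm) hf
    obtain ⟨j', hj'⟩ := add_eq_iterPos_add_of_sameFactor h.lt hj hs.symm
    exact ⟨j', by omega⟩

theorem IsLevel.isSpecial_iff (h : IsLevel k m n) (i : ℕ) :
    IsSpecial wordV (factorAt wordV i n) ↔
      ∃ j, i = 2 * iterPos k j ∨ i = 2 * iterPos k j + offset k n := by
  constructor
  · rintro ⟨-, hi | hi⟩
    · obtain ⟨j, hj⟩ := h.exists_of_leftExt hi
      exact ⟨j, Or.inl hj⟩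
    · obtain ⟨j, hj⟩ := h.exists_of_rightExt hi
      exact ⟨j, Or.inr hj⟩
  · rintro ⟨j, rfl | rfl⟩
    · exact h.isSpecial_prefix j
    · exact h.isSpecial_suffix j

end Level

/-! ### The graphs of symmetries of `v` -/

/-- The morphisms among the symmetries act freely on factors of `v` of length at least two, because
these contain a letter at an odd position, which encodes a parity vector. -/
theorem eq_zero_of_act_factorAt_eq {q : SymIndex} (hq : orient q = 0) {i n : ℕ} (hn : 2 ≤ n)
    (h : act q (factorAt wordV i n) = factorAt wordV i n) : q = 0 := by
  rw [act_factorAt_of_orient_zero hq] at h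
  obtain ⟨r, c, hr, hc⟩ : ∃ r c, r < n ∧ i + r = 2 * c + 1 := by
    rcases Nat.even_or_odd' i with ⟨c, hc | hc⟩
    · exact ⟨1, c, by omega, by omega⟩
    · exact ⟨0, c, by omega, by omega⟩
  have h1 := h r hr
  rw [hc, wordV_odd, letterAct_oddLetter] at h1
  refine ext_orient_shift _ _ hq ?_
  have h2 : shift q = 0 := by simpa using oddLetter_injective h1
  exact h2

section Graph

variable {G : Subgroup (Equiv.Perm (List (Fin 6)))} {lam : SymIndex →+ ZMod 2} {k m n : ℕ}

/-- If a special factor is fixed by an antimorphism, then it covers a bispecial factor of the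
Fibonacci word. -/
theorem IsLevel.offset_eq_zero (h : IsLevel k m n) {q : SymIndex} {j : ℕ} (hq : orient q = 1)
    (hfix : act q (factorAt wordV (2 * iterPos k j) n) = factorAt wordV (2 * iterPos k j) n) :
    offset k n = 0 := by
  obtain ⟨p, hp, hs⟩ := exists_orient_shift 1
    (parity (iterPos k j) + parity (iterPos k j + bispLen k))
  have h1 : act (p + q) (factorAt wordV (2 * iterPos k j) n) =
      factorAt wordV (2 * iterPos k j + offset k n) n := by
    rw [act_add, hfix, h.act_prefix hp hs rfl]
  have hpq : orient (p + q) = 0 := by rw [orient_add, hp, hq]; decide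
  rw [act_factorAt_of_orient_zero hpq] at h1
  have hn := h.length
  have hN := h.offset_add
  have hlt := h.two_mul_iterPos_add_offset_lt j
  rcases Nat.even_or_odd' (offset k n) with ⟨c, hc | hc⟩
  · have hsame : SameFactor (iterPos k j + c) (iterPos k j) m := by
      refine sameFactor_of_parity (t := shift (p + q)) fun r hr => ?_
      have h2 := h1 (2 * r + 1) (by omega)
      rw [hc, show 2 * iterPos k j + (2 * r + 1) = 2 * (iterPos k j + r) + 1 by ring,
        show 2 * iterPos k j + 2 * c + (2 * r + 1) = 2 * (iterPos k j + c + r) + 1 by ring,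
        wordV_odd, wordV_odd, letterAct_oddLetter] at h2
      exact (oddLetter_injective h2).symm
    have h0 := (sameFactor_iterPos k j 0).mono h.le
    rw [iterPos_zero] at h0
    obtain ⟨j', hj'⟩ := eq_iterPos_of_sameFactor h.lt (hsame.trans h0)
    have hjj : j = j' := eq_of_le_of_lt_succ (iterPos_strictMono k) (y := iterPos k j + c)
      (by omega) (by omega) hj'.ge (hj' ▸ iterPos_strictMono k (Nat.lt_succ_self j'))
    subst hjj
    omega
  · have h2 := h1 0 (by omega)
    rw [hc, add_zero, show 2 * iterPos k j + (2 * c + 1) + 0 = 2 * (iterPos k j + c) + 1 by ring,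
      wordV_even, wordV_odd, letterAct_evenLetter] at h2
    exact absurd h2 (evenLetter_ne_oddLetter _ _)

theorem IsLevel.loops_and_tree (h : IsLevel k m n)
    (hG : ∀ ν, ν ∈ G ↔ ∃ q, lam q = 0 ∧ ∀ w, ν w = act q w)
    (hlam : ∀ i j, lam (gen i) ≠ 0 → lam (gen j) ≠ 0 → i = j) :
    (∀ e P, DirectedJoins G wordV n e P P → IsGPalindrome G e) ∧
      IsTreeWithoutLoops G wordV n := by
  obtain ⟨i₀, hi₀⟩ := exists_parity_bispecial k
  have hN := h.offset_add
  have hn := h.length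
  have hp := two_mul_iterPos_strictMono k
  have hg := h.two_mul_iterPos_add_offset_lt
  have hS := h.isSpecial_iff
  have hfin : ∀ i : Fin 3, i + 2 ≠ i ∧ i + 1 ≠ i ∧ i + 1 ≠ i + 2 := by decide
  have hW : ∀ j i, i = 2 * iterPos k j + offset k n →
      act (gen (i₀ + 1)) (factorAt wordV (2 * iterPos k j) n) = factorAt wordV i n := fun j i hi =>
    h.act_prefix (orient_gen _) (by rw [shift_gen, (hi₀ j).1]) hi
  have hspec : ∀ w : List (Fin 6), w.length = n → IsSpecial wordV w →
      ∃ q, w = act q (factorAt wordV 0 n) := by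
    intro w hw hs
    obtain ⟨i, hi⟩ := hs.1
    rw [hw] at hi
    rw [hi] at hs ⊢
    obtain ⟨j, hj⟩ := (hS i).1 hs
    obtain ⟨q, hq⟩ := h.exists_act_prefix 0 j
    rw [iterPos_zero, mul_zero] at hq
    rcases hj with hj | hj
    · exact ⟨q, by rw [hq, hj]⟩
    · exact ⟨gen (i₀ + 1) + q, by rw [act_add, hq, hW j i hj]⟩
  refine loops_and_tree_of_types hG hlam
    (fun i e => (0 < offset k n ∧ i = i₀ + 1 ∧
        ∃ j, e = factorAt wordV (2 * iterPos k j) (offset k n + n)) ∨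
      ∃ j L, i = (if fib j then i₀ + 2 else i₀) ∧
        2 * iterPos k j + offset k n + L = 2 * iterPos k (j + 1) + n ∧
        e = factorAt wordV (2 * iterPos k j + offset k n) L)
    ⟨_, length_factorAt _ _ _, h.isSpecial_prefix 0⟩ ?_ ?_ ?_ ?_ ?_ ?_
  · intro w w' hw hw' hs hs'
    obtain ⟨q, rfl⟩ := hspec w hw hs
    obtain ⟨q', rfl⟩ := hspec w' hw' hs'
    exact ⟨q' + q, by rw [act_add, act_act]⟩
  · intro e he
    rcases he.eq_factorAt hp hg hS with ⟨h0, j, hj⟩ | ⟨j, L, hL, hj⟩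
    · exact ⟨_, Or.inl ⟨h0, rfl, j, hj⟩⟩
    · exact ⟨_, Or.inr ⟨j, L, rfl, hL, hj⟩⟩
  · rintro i e (⟨h0, rfl, j, rfl⟩ | ⟨j, L, rfl, hL, rfl⟩)
    · rw [hN]
      exact act_factorAt_of_isPal (isPal_iterPos k j) (orient_gen _)
        (by rw [shift_gen, (hi₀ j).1]) le_rfl (by omega) (by omega)
    · exact act_factorAt_of_isPal (isPal_return k j) (orient_gen _)
        (by rw [shift_gen, (hi₀ j).2]) (by omega) (by omega) (by omega)
  · rintro i e e' (⟨h0, rfl, j, rfl⟩ | ⟨j, L, rfl, hL, rfl⟩)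
      (⟨h0', hi', j', rfl⟩ | ⟨j', L', hi', hL', rfl⟩)
    · obtain ⟨q, hq, hs⟩ := exists_orient_shift 0 (parity (iterPos k j) + parity (iterPos k j'))
      exact ⟨q, (act_factorAt_of_sameFactor (sameFactor_iterPos k j j') hq hs (r := 0)
        (by omega)).symm⟩
    · split at hi'
      · exact absurd hi' (hfin i₀).2.2
      · exact absurd hi' (hfin i₀).2.1
    · split at hi'
      · exact absurd hi'.symm (hfin i₀).2.2
      · exact absurd hi'.symm (hfin i₀).2.1
    · have hf : fib j = fib j' := by
        have := (hfin i₀).1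
        revert hi'
        cases fib j <;> cases fib j' <;> simp [this, this.symm]
      have hmono := iterPos_strictMono k (Nat.lt_succ_self j)
      obtain ⟨l, hl⟩ : ∃ l, iterPos k j + l = iterPos k (j + 1) + bispLen k :=
        ⟨iterPos k (j + 1) + bispLen k - iterPos k j, by
          simp only [Nat.succ_eq_add_one] at hmono; omega⟩
      obtain ⟨h1, h2⟩ := sameFactor_return k hf hl
      obtain rfl : L = L' := by omega
      obtain ⟨q, hq, hs⟩ := exists_orient_shift 0 (parity (iterPos k j) + parity (iterPos k j'))
      exact ⟨q, (act_factorAt_of_sameFactor h1 hq hs (by omega)).symm⟩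
  · intro i e he hi hlami q hq
    rcases orient_eq q with hq0 | hq1
    · obtain ⟨y, hy⟩ := he.1
      have hle := he.2.1
      rw [hy, take_factorAt _ _ (by omega)] at hq
      rw [eq_zero_of_act_factorAt_eq hq0 (by omega) hq, map_zero]
    · -- The prefix lies over a bispecial factor, hence `q` is the exceptional `Ψ` of another type.
      obtain ⟨j, hj⟩ : ∃ j, act q (factorAt wordV (2 * iterPos k j) n) =
          factorAt wordV (2 * iterPos k j) n := by
        rcases hi with ⟨-, -, j, rfl⟩ | ⟨j, L, -, hL, rfl⟩
        · rw [take_factorAt _ _ (by omega)] at hq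
          exact ⟨j, hq⟩
        · have := hg j
          rw [take_factorAt _ _ (by omega), ← hW j _ rfl, act_comm] at hq
          refine ⟨j, ?_⟩
          have := congrArg (act (gen (i₀ + 1))) hq
          rwa [act_act, act_act] at this
      have h0 := h.offset_eq_zero hq1 hj
      have hne : i ≠ i₀ + 1 := by
        rcases hi with ⟨h0', -⟩ | ⟨j, L, rfl, -⟩
        · omega
        · split
          · exact (hfin i₀).2.2.symm
          · exact (hfin i₀).2.1.symm
      have hsum : q + gen (i₀ + 1) = 0 := by
        refine eq_zero_of_act_factorAt_eq (i := 2 * iterPos k j) (n := n) ?_ (by omega) ?_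
        · rw [orient_add, hq1, orient_gen]; decide
        · rw [act_add, hW j (2 * iterPos k j) (by omega), hj]
      have hqe : q = gen (i₀ + 1) := by
        have := add_self_index (gen (i₀ + 1))
        exact add_right_cancel (hsum.trans this.symm)
      by_contra hc
      exact hne (hlam _ _ hlami (hqe ▸ hc))
  · intro i
    have hcases : ∀ i i₀ : Fin 3, i = i₀ + 1 ∨ i = i₀ + 2 ∨ i = i₀ := by decide
    have hout : ∀ j, ∃ L, 2 * iterPos k j + offset k n + L = 2 * iterPos k (j + 1) + n := fun j =>
      ⟨2 * iterPos k (j + 1) + n - (2 * iterPos k j + offset k n), by have := hg j; omega⟩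
    rcases hcases i i₀ with rfl | rfl | rfl
    · rcases Nat.eq_zero_or_pos (offset k n) with h0 | h0
      · exact Or.inr ⟨_, length_factorAt _ _ _, h.isSpecial_prefix 0, hW 0 _ (by omega)⟩
      · exact Or.inl ⟨_, isDirectedEdge_inner hp hg hS h0 0, Or.inl ⟨h0, rfl, 0, rfl⟩⟩
    · obtain ⟨L, hL⟩ := hout 0
      exact Or.inl ⟨_, isDirectedEdge_outer hp hg hS hL,
        Or.inr ⟨0, L, by simp [fib_zero], hL, rfl⟩⟩
    · obtain ⟨L, hL⟩ := hout 1
      exact Or.inl ⟨_, isDirectedEdge_outer hp hg hS hL,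
        Or.inr ⟨1, L, by simp [fib_one], hL, rfl⟩⟩

theorem isSpecial_singleton_iff (i : ℕ) :
    IsSpecial wordV (factorAt wordV i 1) ↔ ∃ j, i = 2 * j ∨ i = 2 * j + 0 := by
  constructor
  · rintro ⟨-, hi⟩
    rcases Nat.even_or_odd' i with ⟨c, rfl | rfl⟩
    · exact ⟨c, Or.inl rfl⟩
    · exfalso
      rcases hi with ⟨b, hb, b', hb', hne⟩ | ⟨b, hb, b', hb', hne⟩
      · obtain ⟨y, rfl, hy⟩ := cons_mem_language hb
        obtain ⟨y', rfl, hy'⟩ := cons_mem_language hb'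
        have h1 := hy 0 one_pos
        have h1' := hy' 0 one_pos
        have h2 := wordV_eq_mod_two h1
        have h2' := wordV_eq_mod_two h1'
        obtain ⟨a, rfl⟩ : ∃ a, y = 2 * a := ⟨y / 2, by omega⟩
        obtain ⟨a', rfl⟩ : ∃ a', y' = 2 * a' := ⟨y' / 2, by omega⟩
        exact hne (wordV_neighbours_of_odd (h1.trans h1'.symm)).1
      · obtain ⟨y, rfl, hy⟩ := append_mem_language hb
        obtain ⟨y', rfl, hy'⟩ := append_mem_language hb'
        have h1 := hy 0 one_pos
        have h1' := hy' 0 one_pos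
        have h2 := wordV_eq_mod_two h1
        have h2' := wordV_eq_mod_two h1'
        obtain ⟨a, rfl⟩ : ∃ a, y = 2 * a + 1 := ⟨y / 2, by omega⟩
        obtain ⟨a', rfl⟩ : ∃ a', y' = 2 * a' + 1 := ⟨y' / 2, by omega⟩
        exact hne (wordV_neighbours_of_odd (h1.trans h1'.symm)).2
  · rintro ⟨j, hj⟩
    obtain rfl : i = 2 * j := by omega
    -- The morphism `Ψ₀Ψ₂` fixes the letters at even positions and moves those at odd positions.
    have hmem := factorAt_mem_language wordV (2 * j) 2
    have hmem' := act_mem_language (gen 0 + gen 2) hmem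
    rw [act_of_orient_zero (by decide)] at hmem'
    rw [factorAt_succ, factorAt_one] at hmem hmem'
    have h1 : ∀ z, letterAct (gen 0 + gen 2) (evenLetter z) = evenLetter z := by decide
    have h2 : ∀ t, oddLetter t ≠ letterAct (gen 0 + gen 2) (oddLetter t) := by decide
    rw [List.map_append, List.map_singleton, List.map_singleton, wordV_even, h1,
      ← wordV_even] at hmem'
    rw [factorAt_one]
    refine ⟨factorAt_one wordV (2 * j) ▸ factorAt_mem_language _ _ _,
      Or.inr ⟨_, hmem, _, hmem', ?_⟩⟩
    rw [wordV_odd]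
    exact h2 _

theorem loops_and_tree_one
    (hG : ∀ ν, ν ∈ G ↔ ∃ q, lam q = 0 ∧ ∀ w, ν w = act q w)
    (hlam : ∀ i j, lam (gen i) ≠ 0 → lam (gen j) ≠ 0 → i = j) :
    (∀ e P, DirectedJoins G wordV 1 e P P → IsGPalindrome G e) ∧
      IsTreeWithoutLoops G wordV 1 := by
  have hp : StrictMono fun j => 2 * j := fun a b hab => by simp only; omega
  have hg : ∀ j, 2 * j + 0 < 2 * (j + 1) := fun j => by omega
  have hS := isSpecial_singleton_iff
  have hfac : ∀ j, factorAt wordV (2 * j) 1 = [evenLetter j] := fun j => by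
    rw [factorAt_one, wordV_even]
  have hedge : ∀ j, factorAt wordV (2 * j) 3 =
      [evenLetter j, oddLetter (parity j), evenLetter (j + 1)] := fun j => by
    rw [factorAt_succ, factorAt_succ, factorAt_one, wordV_even, wordV_odd, ← Nat.mul_succ,
      wordV_even]
    simp
  have hsingle : ∀ z z', ∃ q, [evenLetter z'] = act q [evenLetter z] := by decide
  refine loops_and_tree_of_types hG hlam
    (fun i e => i = 1 ∧ ∃ j, e = factorAt wordV (2 * j) 3)
    ⟨_, length_factorAt _ _ _, (hS 0).2 ⟨0, Or.inl rfl⟩⟩ ?_ ?_ ?_ ?_ ?_ ?_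
  · have hspec : ∀ w : List (Fin 6), w.length = 1 → IsSpecial wordV w →
        ∃ z, w = [evenLetter z] := by
      intro w hw hs
      obtain ⟨i, hi⟩ := hs.1
      rw [hw] at hi
      rw [hi] at hs ⊢
      obtain ⟨j, hj⟩ := (hS i).1 hs
      exact ⟨j, by rw [show i = 2 * j by omega, hfac]⟩
    intro w w' hw hw' hs hs'
    obtain ⟨z, rfl⟩ := hspec w hw hs
    obtain ⟨z', rfl⟩ := hspec w' hw' hs'
    exact hsingle z z'
  · intro e he
    rcases he.eq_factorAt hp hg hS with ⟨h0, -⟩ | ⟨j, L, hL, rfl⟩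
    · omega
    · exact ⟨1, rfl, j, by rw [show L = 3 by omega]; rfl⟩
  · rintro i e ⟨rfl, j, rfl⟩
    have : ∀ z t, act (gen 1) [evenLetter z, oddLetter t, evenLetter (z + 1)] =
        [evenLetter z, oddLetter t, evenLetter (z + 1)] := by decide
    rw [hedge, this]
  · rintro i e e' ⟨rfl, j, rfl⟩ ⟨-, j', rfl⟩
    obtain ⟨q, hq, hs⟩ := exists_orient_shift 0 (parity j + parity j')
    exact ⟨q, (act_factorAt_of_sameFactor (l := 0) (fun r hr => absurd hr (Nat.not_lt_zero r))
      hq hs (r := 0) (by omega)).symm⟩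
  · rintro i e - ⟨rfl, j, rfl⟩ h1 q hq
    rw [take_factorAt _ _ (by decide), hfac] at hq
    have key : ∀ z q, act q [evenLetter z] = [evenLetter z] →
        q = (if q.1 = 1 then gen 0 else 0) + if q.2.2 = 1 then gen 2 else 0 := by decide
    have h0 : lam (gen 0) = 0 := by
      by_contra hc
      exact absurd (hlam _ _ h1 hc) (by decide)
    have h2 : lam (gen 2) = 0 := by
      by_contra hc
      exact absurd (hlam _ _ h1 hc) (by decide)
    rw [key _ _ hq, map_add]
    split_ifs <;> simp [h0, h2]
  · intro i
    have hfix : ∀ z, act (gen 0) [evenLetter z] = [evenLetter z] ∧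
        act (gen 2) [evenLetter z] = [evenLetter z] := by decide
    have hs0 := (hS 0).2 ⟨0, Or.inl rfl⟩
    have hf0 := hfac 0
    rw [mul_zero] at hf0
    fin_cases i
    · exact Or.inr ⟨_, length_factorAt _ 0 _, hs0, by rw [hf0]; exact (hfix _).1⟩
    · exact Or.inl ⟨_, isDirectedEdge_outer hp hg hS (j := 0) (L := 3) rfl, rfl, 0, rfl⟩
    · exact Or.inr ⟨_, length_factorAt _ 0 _, hs0, by rw [hf0]; exact (hfix _).2⟩

/-- The word `v` is rich for every group generated by at least two of `Ψ₀, Ψ₁, Ψ₂`; such a group is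
the kernel of a linear form not vanishing on at most one of them. -/
theorem gRich_wordV (hG : ∀ ν, ν ∈ G ↔ ∃ q, lam q = 0 ∧ ∀ w, ν w = act q w)
    (hlam : ∀ i j, lam (gen i) ≠ 0 → lam (gen j) ≠ 0 → i = j) : GRich G wordV := by
  intro n hn
  refine ⟨closedUnder_of_forall_act hG, ?_⟩
  rcases hn.eq_or_lt with rfl | hn
  · exact loops_and_tree_one hG hlam
  · obtain ⟨k, m, h⟩ := exists_isLevel hn
    exact h.loops_and_tree hG hlam

end Graph

/-! ### The groups `H` and `H_i` -/

/-- The symmetries form a group isomorphic to `(ℤ/2)³`. -/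
def symHom : Multiplicative SymIndex →* Equiv.Perm (List (Fin 6)) where
  toFun q := (show Function.Involutive (act q.toAdd) from act_act q.toAdd).toPerm
  map_one' := Equiv.ext act_zero
  map_mul' p q := Equiv.ext (act_add p.toAdd q.toAdd)

theorem symHom_gen (i : Fin 3) : symHom (Multiplicative.ofAdd (gen i)) = Psi i :=
  Equiv.ext fun w => act_gen i w

theorem symHom_injective : Function.Injective symHom := by
  have key : ∀ q : SymIndex, act q [1, 2] = [1, 2] → q = 0 := by decide
  refine (injective_iff_map_eq_one symHom).2 fun q hq => ?_
  exact key q.toAdd (congrArg (fun ν : Equiv.Perm (List (Fin 6)) => ν [1, 2]) hq)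

theorem groupH_eq_range : groupH = symHom.range := by
  apply le_antisymm
  · refine (Subgroup.closure_le _).2 ?_
    rintro _ (rfl | rfl | rfl)
    exacts [⟨_, symHom_gen 0⟩, ⟨_, symHom_gen 1⟩, ⟨_, symHom_gen 2⟩]
  · rintro _ ⟨q, rfl⟩
    have hmem : ∀ i, symHom (Multiplicative.ofAdd (gen i)) ∈ groupH := by
      intro i
      rw [symHom_gen]
      refine Subgroup.subset_closure ?_
      fin_cases i <;> simp
    have hq : q = Multiplicative.ofAdd _ := congrArg Multiplicative.ofAdd (eq_sum_gen q.toAdd)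
    have hite : ∀ i (c : Prop) [Decidable c],
        symHom (Multiplicative.ofAdd (if c then gen i else 0)) ∈ groupH := by
      intro i c _
      split
      · exact hmem i
      · rw [ofAdd_zero, map_one]; exact groupH.one_mem
    rw [hq, ofAdd_add, ofAdd_add, map_mul, map_mul]
    exact groupH.mul_mem (hite 0 _) (groupH.mul_mem (hite 1 _) (hite 2 _))

/-- The coordinate of the exponent vector that vanishes on the group `H_i`: the exponent of
`Ψ_{i+2}`. -/
def omitted : Fin 3 → SymIndex →+ ZMod 2 :=
  ![(AddMonoidHom.snd _ _).comp (AddMonoidHom.snd _ _), AddMonoidHom.fst _ _,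
    (AddMonoidHom.fst _ _).comp (AddMonoidHom.snd _ _)]

theorem omitted_eq_zero_iff : ∀ i q, omitted i q = 0 ↔
    q = 0 ∨ q = gen i ∨ q = gen (i + 1) ∨ q = gen i + gen (i + 1) := by decide

theorem mem_groupH_iff (ν : Equiv.Perm (List (Fin 6))) :
    ν ∈ groupH ↔ ∃ q, (0 : SymIndex →+ ZMod 2) q = 0 ∧ ∀ w, ν w = act q w := by
  rw [groupH_eq_range]
  constructor
  · rintro ⟨q, rfl⟩
    exact ⟨q.toAdd, rfl, fun _ => rfl⟩
  · rintro ⟨q, -, h⟩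
    exact ⟨Multiplicative.ofAdd q, Equiv.ext fun w => (h w).symm⟩

theorem groupHi_eq_map (i : Fin 3) :
    groupHi i = (AddSubgroup.toSubgroup (omitted i).ker).map symHom := by
  apply le_antisymm
  · refine (Subgroup.closure_le _).2 ?_
    rintro _ (rfl | rfl)
    · exact ⟨_, (omitted_eq_zero_iff i _).2 (Or.inr (Or.inl rfl)), symHom_gen i⟩
    · exact ⟨_, (omitted_eq_zero_iff i _).2 (Or.inr (Or.inr (Or.inl rfl))), symHom_gen (i + 1)⟩
  · rintro _ ⟨q, hq, rfl⟩
    have h1 : Psi i ∈ groupHi i := Subgroup.subset_closure (by simp)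
    have h2 : Psi (i + 1) ∈ groupHi i := Subgroup.subset_closure (by simp)
    obtain ⟨q, rfl⟩ := Multiplicative.ofAdd.surjective q
    rcases (omitted_eq_zero_iff i q).1 hq with rfl | rfl | rfl | rfl
    · rw [ofAdd_zero, map_one]; exact (groupHi i).one_mem
    · rw [symHom_gen]; exact h1
    · rw [symHom_gen]; exact h2
    · rw [ofAdd_add, map_mul, symHom_gen, symHom_gen]; exact (groupHi i).mul_mem h1 h2

theorem mem_groupHi_iff (i : Fin 3) (ν : Equiv.Perm (List (Fin 6))) :
    ν ∈ groupHi i ↔ ∃ q, omitted i q = 0 ∧ ∀ w, ν w = act q w := by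
  rw [groupHi_eq_map]
  constructor
  · rintro ⟨q, hq, rfl⟩
    exact ⟨q.toAdd, hq, fun _ => rfl⟩
  · rintro ⟨q, hq, h⟩
    exact ⟨Multiplicative.ofAdd q, hq, Equiv.ext fun w => (h w).symm⟩

theorem finite_groupH : Finite groupH := by
  rw [groupH_eq_range]
  exact Set.finite_range symHom

theorem groupHi_le_groupH (i : Fin 3) : groupHi i ≤ groupH := by
  rw [groupHi_eq_map, groupH_eq_range]
  exact Subgroup.map_le_range _ _

theorem isSymmetryGroup_of_le {G : Subgroup (Equiv.Perm (List (Fin 6)))} (hG : G ≤ groupH)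
    {i : Fin 3} (hi : Psi i ∈ G) : IsSymmetryGroup G where
  morphism_or_antimorphism ν hν := by
    obtain ⟨q, -, hq⟩ := (mem_groupH_iff ν).1 (hG hν)
    have hq : ⇑ν = act q := funext hq
    rcases orient_eq q with h | h
    · exact Or.inl (hq ▸ isMorphism_act h)
    · exact Or.inr (hq ▸ isAntimorphism_act h)
  finite := by
    have := finite_groupH
    exact Finite.of_injective _ (Subgroup.inclusion_injective hG)
  exists_antimorphism := ⟨Psi i, hi, by
    have : ⇑(Psi i) = act (gen i) := funext fun w => (act_gen i w).symm
    exact this ▸ isAntimorphism_act (orient_gen i)⟩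

theorem nonempty_groupH_mulEquiv :
    Nonempty (groupH ≃* Multiplicative (ZMod 2 × ZMod 2 × ZMod 2)) := by
  rw [groupH_eq_range]
  exact ⟨(MonoidHom.ofInjective symHom_injective).symm⟩

theorem card_groupHi (i : Fin 3) : Nat.card (groupHi i) = 4 := by
  rw [groupHi_eq_map, Subgroup.card_map_of_injective symHom_injective]
  have key : ∀ i, Fintype.card {q : SymIndex // omitted i q = 0} = 4 := by decide
  rw [← key i, ← Nat.card_eq_fintype_card]
  exact Nat.card_congr (Equiv.subtypeEquiv Multiplicative.toAdd fun q => Iff.rfl)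

theorem singleton_mem_language_wordV (b : Fin 6) : [b] ∈ language wordV := by
  have h : ∀ b, ∃ i, i < 8 ∧ [b] = factorAt wordV i 1 := by decide
  obtain ⟨i, -, hi⟩ := h b
  exact hi ▸ factorAt_mem_language _ _ _

end SymWords

theorem mainTheorem8 :
    -- the word `u` is the unique fixed point of `φ`
    (∀ w : ℕ → Fin 8, SymWords.applyInf SymWords.phi w = w ↔ w = SymWords.wordU) ∧
    -- all six letters occur in `v`
    (∀ b : Fin 6, [b] ∈ SymWords.language SymWords.wordV) ∧
    -- the group `H`
    SymWords.IsSymmetryGroup SymWords.groupH ∧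
    Nonempty (SymWords.groupH ≃* Multiplicative (ZMod 2 × ZMod 2 × ZMod 2)) ∧
    SymWords.ClosedUnder SymWords.groupH SymWords.wordV ∧
    SymWords.GRich SymWords.groupH SymWords.wordV ∧
    -- the groups `H_0`, `H_1`, `H_2`
    (∀ i : Fin 3,
      SymWords.IsSymmetryGroup (SymWords.groupHi i) ∧
      SymWords.groupHi i ≤ SymWords.groupH ∧
      Nat.card (SymWords.groupHi i) = 4 ∧
      SymWords.GRich (SymWords.groupHi i) SymWords.wordV) := by
  open SymWords in
  have hlam : ∀ i j k, omitted i (gen j) ≠ 0 → omitted i (gen k) ≠ 0 → j = k := by decide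
  exact ⟨applyInf_phi_eq_self_iff, singleton_mem_language_wordV,
    isSymmetryGroup_of_le le_rfl (i := 0) (Subgroup.subset_closure (by simp)),
    nonempty_groupH_mulEquiv, closedUnder_of_forall_act mem_groupH_iff,
    gRich_wordV mem_groupH_iff fun i j h => absurd rfl h, fun i =>
    ⟨isSymmetryGroup_of_le (groupHi_le_groupH i) (i := i) (Subgroup.subset_closure (by simp)),
      groupHi_le_groupH i, card_groupHi i, gRich_wordV (mem_groupHi_iff i) (hlam i)⟩⟩
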